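/- Let $n\ge 1$ and $k\ge 2$ be integers and let $q\in\mathbb C^\times$. If $q$ is a root of unity, let $\ell$ be the smallest positive integer with $q^{2\ell}=1$ and assume $\ell>k$. (If $q$ is not a root of unity, $\ell$ is undefined and the condition "$k+1\equiv 0 \bmod \ell$" is understood to fail.) Put $\beta=q+q^{-1}$, $N=n+k$ and $[m]=(q^m-q^{-m})/(q-q^{-1})$. An $(m,p)$-diagram consists of $m$ points on the left side and $p$ points on the right side of a rectangle, connected pairwise by non-crossing links, up to isotopy. Diagrams are composed by concatenation, each closed loop being replaced by a factor $\beta$, and $D^*$ denotes the left-right reflection of $D$. An $(m,p)$-diagram is monic if $p$ of its links cross from left to right. The Temperley-Lieb algebra $\mathsf{TL}_N(\beta)$ is spanned by the $(N,N)$-diagrams. For $1\le i<N$, $E_i\in\mathsf{TL}_N(\beta)$ is the diagram that links the points $i$ and $i+1$ (numbered from the top) on either side and every other point to the one opposite to it. The Wenzl-Jones projectors are $P_1=\mathrm{Id}$, $P_j=P_{j-1}-\frac{[j-1]}{[j]}P_{j-1}E_{N-j+1}P_{j-1}$ for $1<j\le k$. For $0\le d\le N$, $d\equiv N \bmod 2$,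 the standard module $S_N^d$ is the span of the monic $(N,d)$-diagrams, with $\mathsf{TL}_N(\beta)$ acting by composition and non-monic results set to zero; the cellular module $S_{n,k}^d$ of the boundary seam algebra is the subspace of $S_N^d$ spanned by the elements $P_kw$, $w$ a monic $(N,d)$-diagram. Its invariant bilinear form $\langle\cdot,\cdot\rangle_{n,k}^d$ is given by: $\langle P_kv,P_kw\rangle_{n,k}^d$ is the coefficient of the identity (the only monic) $(d,d)$-diagram in the composition $(P_kv)^*(P_kw)$. Let $\Delta_{n,k}=\{d\in\mathbb N : 0\le d\le n+k,\ d\equiv n+k \bmod 2,\ n+d\ge k\}$. **Proposition.** Let $d\in\Delta_{n,k}$. The bilinear form $\langle\cdot,\cdot\rangle_{n,k}^d$ is identically zero if and only if $d<k$ and $k+1\equiv 0 \bmod \ell$. Moreover, under the above assumptions, the condition $k+1\equiv 0\bmod \ell$ is equivalent to $\ell=k+1$. -/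

import Mathlib

noncomputable section

/-- Position of a marked point of an `(m, n)`-diagram when one walks around the rectangle: down the
left side (points `0, …, m - 1`, numbered from top to bottom), then up the right side (points
`n - 1, …, 0`, also numbered from top to bottom). -/
def tlPos (m n : ℕ) : Fin m ⊕ Fin n → ℕ
  | Sum.inl i => i
  | Sum.inr j => m + n - 1 - j

/-- An `(m, n)`-diagram up to isotopy: `m` points on the left side and `n` points on the right side
of a rectangle, connected pairwise by non-crossing links. `link a` is the other end of the link
at `a`. -/
@[ext]
structure TLDiagram (m n : ℕ) where
  link : Fin m ⊕ Fin n → Fin m ⊕ Fin n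
  link_link : ∀ a, link (link a) = a
  link_ne : ∀ a, link a ≠ a
  planar : ∀ a b, ¬ (tlPos m n a < tlPos m n b ∧ tlPos m n b < tlPos m n (link a) ∧
    tlPos m n (link a) < tlPos m n (link b))

namespace TLDiagram

variable {m n p : ℕ}

instance : Finite (TLDiagram m n) :=
  Finite.of_injective (fun D : TLDiagram m n => D.link) (fun _ _ h => TLDiagram.ext h)

instance : Fintype (TLDiagram m n) := Fintype.ofFinite _

instance : DecidableEq (TLDiagram m n) := Classical.decEq _

/-- The identity diagram. -/
protected def id (n : ℕ) : TLDiagram n n where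
  link := Sum.swap
  link_link a := Sum.swap_swap a
  link_ne a := by cases a <;> simp
  planar := by
    rintro (⟨a, ha⟩ | ⟨a, ha⟩) (⟨b, hb⟩ | ⟨b, hb⟩) <;> simp only [tlPos, Sum.swap_inl, Sum.swap_inr] <;> omega

/-- The links of the diagram `E_{i+1}`: the points `i` and `i + 1` (counted from `0`) are linked on
either side, and every other point is linked to the point opposite to it. -/
def eLink (n i : ℕ) (h : i + 1 < n) : Fin n ⊕ Fin n → Fin n ⊕ Fin n
  | Sum.inl a => if (a : ℕ) = i then Sum.inl ⟨i + 1, h⟩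
      else if (a : ℕ) = i + 1 then Sum.inl ⟨i, by omega⟩ else Sum.inr a
  | Sum.inr a => if (a : ℕ) = i then Sum.inr ⟨i + 1, h⟩
      else if (a : ℕ) = i + 1 then Sum.inr ⟨i, by omega⟩ else Sum.inl a

/-- The diagram `E_{i+1}` with `n` points on either side. -/
def e (n i : ℕ) (h : i + 1 < n) : TLDiagram n n where
  link := eLink n i h
  link_link := by
    rintro (⟨a, ha⟩ | ⟨a, ha⟩) <;> simp only [eLink] <;> split_ifs <;>
      simp_all
  link_ne := by
    rintro (⟨a, ha⟩ | ⟨a, ha⟩) <;> simp only [eLink] <;> split_ifs <;>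
      simp_all
  planar := by
    rintro (⟨a, ha⟩ | ⟨a, ha⟩) (⟨b, hb⟩ | ⟨b, hb⟩) <;> simp only [eLink] <;> split_ifs <;>
      simp only [tlPos] <;> omega

lemma tlPos_swap (a : Fin m ⊕ Fin n) : tlPos n m a.swap + tlPos m n a + 1 = m + n := by
  rcases a with ⟨a, ha⟩ | ⟨a, ha⟩ <;> simp only [tlPos, Sum.swap_inl, Sum.swap_inr] <;> omega

/-- The reflection `D^*` of a diagram through a vertical mirror. -/
def reflect (D : TLDiagram m n) : TLDiagram n m where
  link a := (D.link a.swap).swap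
  link_link a := by simp [D.link_link]
  link_ne a h := D.link_ne a.swap (by simpa using congrArg Sum.swap h)
  planar a b h := by
    have h1 := tlPos_swap (D.link a.swap)
    have h2 := tlPos_swap (D.link b.swap)
    have h3 := tlPos_swap a
    have h4 := tlPos_swap b
    apply D.planar (D.link b.swap) (D.link a.swap)
    rw [D.link_link, D.link_link]
    omega

/-- An `(m, n)`-diagram is monic if it has `n` links crossing from left to right, that is, if every
point on the right is linked to a point on the left. -/
def IsMonic (D : TLDiagram m n) : Prop := ∀ j : Fin n, ∃ i : Fin m, D.link (Sum.inr j) = Sum.inl i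

/-- The points of the left factor, inside the drawing of two diagrams glued side by side. -/
def leftPt : Fin m ⊕ Fin n → Fin m ⊕ (Fin n ⊕ Fin p)
  | Sum.inl i => Sum.inl i
  | Sum.inr j => Sum.inr (Sum.inl j)

/-- The points of the right factor, inside the drawing of two diagrams glued side by side. -/
def rightPt (x : Fin n ⊕ Fin p) : Fin m ⊕ (Fin n ⊕ Fin p) := Sum.inr x

/-- The points of the outer sides, inside the drawing of two diagrams glued side by side. -/
def outerPt : Fin m ⊕ Fin p → Fin m ⊕ (Fin n ⊕ Fin p)
  | Sum.inl i => Sum.inl i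
  | Sum.inr j => Sum.inr (Sum.inr j)

/-- The drawing obtained by putting an `(m, n)`-diagram and an `(n, p)`-diagram side by side and
identifying the `n` points in the middle: its edges are the links of both diagrams. -/
def glue (D₁ : TLDiagram m n) (D₂ : TLDiagram n p) : SimpleGraph (Fin m ⊕ (Fin n ⊕ Fin p)) :=
  SimpleGraph.fromRel fun x y =>
    (∃ a, x = leftPt a ∧ y = leftPt (D₁.link a)) ∨ (∃ a, x = rightPt a ∧ y = rightPt (D₂.link a))

/-- `D` is the diagram left by the concatenation of `D₁` and `D₂` once the closed loops are removed:
two distinct outer points are linked in `D` exactly when a curve of the drawing joins them. -/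
def IsConcat (D₁ : TLDiagram m n) (D₂ : TLDiagram n p) (D : TLDiagram m p) : Prop :=
  ∀ a b, D.link a = b ↔ a ≠ b ∧ (glue D₁ D₂).Reachable (outerPt a) (outerPt b)

/-- The number of closed loops in the concatenation of `D₁` and `D₂`: the number of curves of the
drawing that meet no outer point. -/
def loops (D₁ : TLDiagram m n) (D₂ : TLDiagram n p) : ℕ :=
  Nat.card {c : (glue D₁ D₂).ConnectedComponent //
    ∀ a, (glue D₁ D₂).connectedComponentMk (outerPt a) ≠ c}

open Classical in
/-- The coefficient of the diagram `D` in the composition `D₁ D₂`: each closed loop is replaced by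
a factor `β`. -/
def compCoeff (β : ℂ) (D₁ : TLDiagram m n) (D₂ : TLDiagram n p) (D : TLDiagram m p) : ℂ :=
  if IsConcat D₁ D₂ D then β ^ loops D₁ D₂ else 0

end TLDiagram

/-- The vector space `TL_n` of formal complex linear combinations of `(n, n)`-diagrams; such a
combination is given by its coefficients. -/
abbrev TL (n : ℕ) : Type := TLDiagram n n → ℂ

/-- The product of the Temperley-Lieb algebra `TL_n(β)`, the bilinear extension of the composition
of diagrams. -/
def tlMul (β : ℂ) {n : ℕ} (x y : TL n) : TL n := fun D =>
  ∑ D₁ : TLDiagram n n, ∑ D₂ : TLDiagram n n, x D₁ * y D₂ * TLDiagram.compCoeff β D₁ D₂ D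

/-- The identity of `TL_n`. -/
def tlOne (n : ℕ) : TL n := Pi.single (TLDiagram.id n) 1

/-- The generator `E_{i+1}` of `TL_n`, `0 ≤ i < n - 1` (and `0` for other values of `i`). -/
def tlE (n i : ℕ) : TL n := if h : i + 1 < n then Pi.single (TLDiagram.e n i h) 1 else 0

/-- The `q`-number `[m] = (q^m - q^{-m}) / (q - q^{-1})`. -/
def qNum (q : ℂ) (m : ℕ) : ℂ := (q ^ m - (q⁻¹) ^ m) / (q - q⁻¹)

/-- The loop weight `β = q + q^{-1}`. -/
def loopWeight (q : ℂ) : ℂ := q + q⁻¹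

/-- The Wenzl-Jones projector `P_k` in `TL_N(q + q^{-1})`, acting on the `k` bottom points:
`P_1 = Id` and `P_k = P_{k-1} - ([k-1] / [k]) P_{k-1} E_{N-k+1} P_{k-1}` for `1 < k ≤ N`
(`P_0 = Id` is a convention). -/
def wenzlJones (q : ℂ) (N : ℕ) : ℕ → TL N
  | 0 => tlOne N
  | 1 => tlOne N
  | k + 2 => wenzlJones q N (k + 1) - (qNum q (k + 1) / qNum q (k + 2)) •
      tlMul (loopWeight q) (tlMul (loopWeight q) (wenzlJones q N (k + 1)) (tlE N (N - (k + 2))))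
        (wenzlJones q N (k + 1))

/-- The monic `(n, d)`-diagrams. -/
abbrev MonicDiagram (n d : ℕ) : Type := {w : TLDiagram n d // w.IsMonic}

instance (n d : ℕ) : Fintype (MonicDiagram n d) := Fintype.ofFinite _

instance (n d : ℕ) : DecidableEq (MonicDiagram n d) := Classical.decEq _

/-- The vector space underlying the standard (cellular) module `S_n^d` over `TL_n`: formal linear
combinations of monic `(n, d)`-diagrams. -/
abbrev StdModule (n d : ℕ) : Type := MonicDiagram n d → ℂ

/-- The action of `TL_n(β)` on `S_n^d`: composition of diagrams, a composite which is not monic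
being set to zero. -/
def stdAct (β : ℂ) {n d : ℕ} (x : TL n) (v : StdModule n d) : StdModule n d := fun w =>
  ∑ D : TLDiagram n n, ∑ u : MonicDiagram n d, x D * v u * TLDiagram.compCoeff β D u.1 w.1

/-- The bilinear form on `S_n^d`: for monic diagrams `v` and `w` it is the coefficient of the
identity, which is the only monic `(d, d)`-diagram, in the composition `v^* w`. -/
def stdForm (β : ℂ) (n d : ℕ) : LinearMap.BilinForm ℂ (StdModule n d) :=
  LinearMap.mk₂ ℂ
    (fun x y => ∑ v : MonicDiagram n d, ∑ w : MonicDiagram n d,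
      x v * y w * TLDiagram.compCoeff β v.1.reflect w.1 (TLDiagram.id d))
    (fun x x' y => by simp [add_mul, Finset.sum_add_distrib])
    (fun c x y => by simp [Finset.mul_sum, mul_assoc])
    (fun x y y' => by simp [mul_add, add_mul, Finset.sum_add_distrib])
    (fun c x y => by simp [Finset.mul_sum, mul_assoc, mul_left_comm])

/-- The cellular module `S_{n,k}^d` of the boundary seam algebra `b_{n,k}(q + q^{-1})`: the span,
inside `S_{n+k}^d`, of the elements `P_k w` with `w` a monic `(n + k, d)`-diagram. -/
def seamModule (q : ℂ) (n k d : ℕ) : Submodule ℂ (StdModule (n + k) d) :=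
  Submodule.span ℂ (Set.range fun w : MonicDiagram (n + k) d =>
    stdAct (loopWeight q) (wenzlJones q (n + k) k) (Pi.single w 1))

/-- The bilinear form on `S_{n,k}^d`: the value on `(P_k v, P_k w)` is the factor in front of the
identity `(d, d)`-diagram in the concatenation `(P_k v)^* (P_k w)`. -/
def seamForm (q : ℂ) (n k d : ℕ) : LinearMap.BilinForm ℂ (seamModule q n k d) :=
  (stdForm (loopWeight q) (n + k) d).restrict (seamModule q n k d)

/-- The index set `Δ_{n,k}` of the cellular modules of `b_{n,k}`. -/
def seamDelta (n k : ℕ) : Set ℕ := {d | d ≤ n + k ∧ d ≡ n + k [MOD 2] ∧ k ≤ n + d}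

/-- The smallest positive integer `ℓ` with `q^{2ℓ} = 1`, if `q` is a root of unity; it is `0` if `q`
is not a root of unity (and then no positive integer is congruent to `0` modulo `ℓ`). -/
def ell (q : ℂ) : ℕ := orderOf (q ^ 2)

end

/-! The proof compares the form with the Markov trace, in which every loop of the closure of a
diagram contributes β. As `P_k` is idempotent and fixed by reflection, the form on `P_k v`, `P_k w`
is the coefficient of the identity in `v^* P_k w`. The projector `P_d` on all `d` strands kills
every diagram other than the identity and has trace `[d+1]`, so `tr(P_d y)` is `[d+1]` times the
coefficient of the identity in `y`. By cyclicity the form times `[d+1]` is `tr(P_k w P_d v^*)`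
(`form_mul_qNum`).

On the other hand, `tr(P_k D)` is a multiple of `[k+1]` for every diagram `D`: closing the strands
that `P_k` does not touch leaves a diagram on `k` strands, which `P_k` kills unless it is the
identity (`exists_hTrace_wjProj_basis`). If `d < k` then `[d+1] ≠ 0`, so `[k+1] = 0` makes the form
vanish (`form_eq_zero`).

Conversely, a test diagram `W` has its defects at the bottom and no arc between two of the `k`
bottom points. If `d < k`, then `P_d` may be replaced by the identity in `tr(P_k W P_d W^*)`, which
becomes a nonzero multiple of `[k+1]` (`IsTestDiagram.form_ne_zero_of_lt`). If `d ≥ k`, it is `P_k`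
that may be dropped, and the form on `W` is a power of β (`IsTestDiagram.form_ne_zero_of_le`); here
`β = [2] ≠ 0` because `k ≥ 2`. Finally `[m] = 0` exactly when `ℓ` divides `m`.

The calculus of diagrams rests on two devices. Degree and parity counts show that a glued drawing
defines a planar diagram (`comp`). The 0-1 matrix of compatible two-colourings is then injective on
diagrams and turns concatenation into a matrix product with loop value 2 (`K_mul`); since powers of
2 determine their exponents, identities between composites and loop numbers follow from matrix
identities and hold for every β. -/

noncomputable section

/-- A connected graph has at least `|V| - 1` edges, and the degrees add up to twice the number of
edges. -/
theorem SimpleGraph.Connected.two_mul_card_le {V : Type*} [Fintype V] [DecidableEq V]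
    {G : SimpleGraph V} (hG : G.Connected) (nb : V → ℕ)
    (h : ∀ v (s : Finset V), (∀ u ∈ s, G.Adj v u) → s.card ≤ nb v) :
    2 * Fintype.card V ≤ ∑ v, nb v + 2 := by
  classical
  have h1 := hG.card_vert_le_card_edgeSet_add_one
  have h2 := G.sum_degrees_eq_twice_card_edges
  have h3 : ∑ v, G.degree v ≤ ∑ v, nb v :=
    Finset.sum_le_sum fun v _ => h v (G.neighborFinset v) fun u hu => by simpa using hu
  rw [Nat.card_eq_fintype_card, Nat.card_eq_fintype_card, ← SimpleGraph.edgeFinset_card] at h1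
  omega

/-! ### Curves in the drawing of two glued diagrams -/

namespace TLDiagram

variable {m n p : ℕ}

lemma leftPt_injective : Function.Injective (leftPt : Fin m ⊕ Fin n → Fin m ⊕ (Fin n ⊕ Fin p)) := by
  rintro (a | a) (b | b) h <;> simp_all [leftPt]

lemma rightPt_injective :
    Function.Injective (rightPt : Fin n ⊕ Fin p → Fin m ⊕ (Fin n ⊕ Fin p)) :=
  fun _ _ h => Sum.inr_injective h

lemma outerPt_injective :
    Function.Injective (outerPt : Fin m ⊕ Fin p → Fin m ⊕ (Fin n ⊕ Fin p)) := by
  rintro (a | a) (b | b) h <;> simp_all [outerPt]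

lemma glue_adj_left (D₁ : TLDiagram m n) (D₂ : TLDiagram n p) (a : Fin m ⊕ Fin n) :
    (glue D₁ D₂).Adj (leftPt a) (leftPt (D₁.link a)) := by
  rw [glue, SimpleGraph.fromRel_adj]
  exact ⟨fun h => D₁.link_ne a (leftPt_injective h).symm, Or.inl (Or.inl ⟨a, rfl, rfl⟩)⟩

lemma glue_adj_right (D₁ : TLDiagram m n) (D₂ : TLDiagram n p) (a : Fin n ⊕ Fin p) :
    (glue D₁ D₂).Adj (rightPt a) (rightPt (D₂.link a)) := by
  rw [glue, SimpleGraph.fromRel_adj]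
  exact ⟨fun h => D₂.link_ne a (rightPt_injective h).symm, Or.inl (Or.inr ⟨a, rfl, rfl⟩)⟩

lemma glue_adj_iff (D₁ : TLDiagram m n) (D₂ : TLDiagram n p) (x y) :
    (glue D₁ D₂).Adj x y ↔ (∃ a, x = leftPt a ∧ y = leftPt (D₁.link a)) ∨
      (∃ a, x = rightPt a ∧ y = rightPt (D₂.link a)) := by
  constructor
  · intro h
    rw [glue, SimpleGraph.fromRel_adj] at h
    rcases h.2 with h | ⟨a, rfl, rfl⟩ | ⟨a, rfl, rfl⟩
    · exact h
    · exact Or.inl ⟨D₁.link a, rfl, by rw [D₁.link_link]⟩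
    · exact Or.inr ⟨D₂.link a, rfl, by rw [D₂.link_link]⟩
  · rintro (⟨a, rfl, rfl⟩ | ⟨a, rfl, rfl⟩)
    · exact glue_adj_left D₁ D₂ a
    · exact glue_adj_right D₁ D₂ a

/-- The possible neighbours of a point of the drawing. -/
def glueNbhd (D₁ : TLDiagram m n) (D₂ : TLDiagram n p) :
    Fin m ⊕ (Fin n ⊕ Fin p) → Finset (Fin m ⊕ (Fin n ⊕ Fin p))
  | Sum.inl i => {leftPt (D₁.link (Sum.inl i))}
  | Sum.inr (Sum.inl j) => {leftPt (D₁.link (Sum.inr j)), rightPt (D₂.link (Sum.inl j))}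
  | Sum.inr (Sum.inr k) => {rightPt (D₂.link (Sum.inr k))}

lemma mem_glueNbhd {D₁ : TLDiagram m n} {D₂ : TLDiagram n p} {x y}
    (h : (glue D₁ D₂).Adj x y) : y ∈ glueNbhd D₁ D₂ x := by
  rcases (glue_adj_iff D₁ D₂ x y).1 h with ⟨a | a, rfl, rfl⟩ | ⟨a | a, rfl, rfl⟩ <;>
    simp [leftPt, rightPt, glueNbhd]

/-- `1` on the outer points of the drawing and `0` on the points in the middle. -/
def outerWeight : Fin m ⊕ (Fin n ⊕ Fin p) → ℕ
  | Sum.inl _ => 1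
  | Sum.inr (Sum.inl _) => 0
  | Sum.inr (Sum.inr _) => 1

lemma outerWeight_outerPt (a : Fin m ⊕ Fin p) :
    outerWeight (outerPt a : Fin m ⊕ (Fin n ⊕ Fin p)) = 1 := by
  rcases a with a | a <;> rfl

lemma card_glueNbhd (D₁ : TLDiagram m n) (D₂ : TLDiagram n p) (x) :
    (glueNbhd D₁ D₂ x).card ≤ 2 - outerWeight x := by
  rcases x with x | x | x <;> simp only [glueNbhd, outerWeight, Finset.card_singleton]
  · norm_num
  · exact Finset.card_le_two
  · norm_num

lemma outerWeight_le (x : Fin m ⊕ (Fin n ⊕ Fin p)) : outerWeight x ≤ 2 := by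
  rcases x with x | x | x <;> simp [outerWeight]

/-- Middle points have degree at most 2 and outer points at most 1, whereas connectedness forces the
degrees to sum to at least `2|c| - 2`. This leaves room for at most two outer points in a component.
-/
lemma sum_outerWeight_le (D₁ : TLDiagram m n) (D₂ : TLDiagram n p)
    (c : (glue D₁ D₂).ConnectedComponent) [Fintype c] :
    ∑ x : c, outerWeight x.1 ≤ 2 := by
  classical
  have h := c.connected_toSimpleGraph.two_mul_card_le (fun x => 2 - outerWeight x.1)
    (fun v s hs => by
      refine le_trans ?_ (card_glueNbhd D₁ D₂ v.1)
      rw [← Finset.card_map (Function.Embedding.subtype _)]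
      refine Finset.card_le_card fun y hy => ?_
      obtain ⟨u, hu, rfl⟩ := Finset.mem_map.1 hy
      exact mem_glueNbhd ((c.toSimpleGraph_adj v.2 u.2).1 (hs u hu)))
  have h2 : ∑ x : c, (2 - outerWeight x.1) + ∑ x : c, outerWeight x.1 = 2 * Fintype.card c := by
    rw [← Finset.sum_add_distrib, Finset.sum_congr rfl fun x _ =>
      Nat.sub_add_cancel (outerWeight_le x.1)]
    simp [mul_comm]
  omega

lemma not_three_outer (D₁ : TLDiagram m n) (D₂ : TLDiagram n p) {a b c : Fin m ⊕ Fin p}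
    (hab : a ≠ b) (hac : a ≠ c) (hbc : b ≠ c)
    (h1 : (glue D₁ D₂).Reachable (outerPt a) (outerPt b))
    (h2 : (glue D₁ D₂).Reachable (outerPt a) (outerPt c)) : False := by
  classical
  let C := (glue D₁ D₂).connectedComponentMk (outerPt a)
  have : Fintype C := Fintype.ofFinite _
  have hA : outerPt a ∈ C := rfl
  have hB : outerPt b ∈ C := SimpleGraph.ConnectedComponent.sound h1.symm
  have hC : outerPt c ∈ C := SimpleGraph.ConnectedComponent.sound h2.symm
  let s : Finset C := {⟨outerPt a, hA⟩, ⟨outerPt b, hB⟩, ⟨outerPt c, hC⟩}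
  have hs : ∑ x ∈ s, outerWeight x.1 = 3 := by
    have e1 := fun h => hab (outerPt_injective (n := n) h)
    have e2 := fun h => hac (outerPt_injective (n := n) h)
    have e3 := fun h => hbc (outerPt_injective (n := n) h)
    rw [Finset.sum_insert, Finset.sum_insert, Finset.sum_singleton]
    · simp only [outerWeight_outerPt, Nat.reduceAdd]
    · simpa using e3
    · simpa using ⟨e1, e2⟩
  have := Finset.sum_le_univ_sum_of_nonneg (s := s) (f := fun x : C => outerWeight x.1)
    (fun _ => Nat.zero_le _)
  have := sum_outerWeight_le D₁ D₂ C
  omega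

/-! ### Parity -/

lemma sum_eq_zero_of_link_invariant (D : TLDiagram m n) (f : Fin m ⊕ Fin n → ZMod 2)
    (hf : ∀ a, f (D.link a) = f a) : ∑ a, f a = 0 :=
  Finset.sum_involution (fun a _ => D.link a) (fun a _ => by rw [hf]; exact CharTwo.add_self_eq_zero _)
    (fun a _ _ => D.link_ne a) (fun _ _ => Finset.mem_univ _) (fun a _ => D.link_link a)

/-- The number modulo `2` of pairs of a point of `f` and a later point of `g`. -/
def crossing (f g : Fin m ⊕ Fin n → ZMod 2) : ZMod 2 :=
  ∑ a, ∑ b, if tlPos m n a < tlPos m n b then f a * g b else 0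

lemma tlPos_injective (m n : ℕ) : Function.Injective (tlPos m n) := by
  rintro (⟨a, ha⟩ | ⟨a, ha⟩) (⟨b, hb⟩ | ⟨b, hb⟩) h <;> simp only [tlPos] at h <;> simp <;> omega

/-- The counts from the two ends of a chord differ by the number of `g`-points strictly under it. By
planarity the points under a chord are linked among themselves, so that number is even. -/
lemma crossing_chord (D : TLDiagram m n) (f g : Fin m ⊕ Fin n → ZMod 2)
    (hg : ∀ a, g (D.link a) = g a) (hfg : ∀ a, f a * g a = 0)
    (hf : ∀ a, f (D.link a) = f a) (a) (hlt : tlPos m n a < tlPos m n (D.link a)) :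
    (∑ b, if tlPos m n a < tlPos m n b then f a * g b else 0) +
      (∑ b, if tlPos m n (D.link a) < tlPos m n b then f (D.link a) * g b else 0) = 0 := by
  rw [← Finset.sum_add_distrib, hf]
  let h : Fin m ⊕ Fin n → ZMod 2 := fun b =>
    if tlPos m n a < tlPos m n b ∧ tlPos m n b < tlPos m n (D.link a) then f a * g b else 0
  refine Eq.trans (Finset.sum_congr rfl fun b _ => ?_) (sum_eq_zero_of_link_invariant D h ?_)
  · simp only [h]
    rcases lt_trichotomy (tlPos m n b) (tlPos m n (D.link a)) with hb | hb | hb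
    · simp [hb, hb.not_gt]
    · obtain rfl := tlPos_injective m n hb
      rw [hg, hfg]
      simp
    · rw [if_pos (hlt.trans hb), if_pos hb, if_neg (fun h => hb.not_gt h.2)]
      exact CharTwo.add_self_eq_zero _
  · intro b
    simp only [h, hg]
    congr 1
    apply propext
    by_cases h1 : b = a
    · subst h1; simp
    by_cases h2 : b = D.link a
    · subst h2; simp [D.link_link]
    have n1 : tlPos m n b ≠ tlPos m n a := fun h => h1 (tlPos_injective m n h)
    have n2 : tlPos m n b ≠ tlPos m n (D.link a) := fun h => h2 (tlPos_injective m n h)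
    have n3 : tlPos m n (D.link b) ≠ tlPos m n a := fun h => h2 (by
      rw [← tlPos_injective m n h, D.link_link])
    have n4 : tlPos m n (D.link b) ≠ tlPos m n (D.link a) := fun h => h1 (by
      rw [← D.link_link b, tlPos_injective m n h, D.link_link])
    have p1 := D.planar a b
    have p2 := D.planar a (D.link b)
    have p3 := D.planar b a
    have p4 := D.planar (D.link b) a
    rw [D.link_link] at p2 p4
    omega

lemma crossing_eq_zero (D : TLDiagram m n) (f g : Fin m ⊕ Fin n → ZMod 2)
    (hf : ∀ a, f (D.link a) = f a) (hg : ∀ a, g (D.link a) = g a) (hfg : ∀ a, f a * g a = 0) :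
    crossing f g = 0 := by
  refine Finset.sum_involution (fun a _ => D.link a) (fun a _ => ?_)
    (fun a _ _ => D.link_ne a) (fun _ _ => Finset.mem_univ _) (fun a _ => D.link_link a)
  rcases lt_trichotomy (tlPos m n a) (tlPos m n (D.link a)) with h | h | h
  · exact crossing_chord D f g hg hfg hf a h
  · exact absurd (tlPos_injective m n h).symm (D.link_ne a)
  · have := crossing_chord D f g hg hfg hf (D.link a) (by rwa [D.link_link])
    rw [D.link_link] at this
    rwa [add_comm]

/-- The number modulo `2` of pairs of a point of `u` and a later point of `v`, for points on a
line. -/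
def lineCrossing (u v : Fin n → ZMod 2) : ZMod 2 := ∑ i, ∑ j, if i < j then u i * v j else 0

/-- In the walk around the rectangle every left point precedes every right point and the right side
is traversed upwards, which is why `f` and `g` change places in the last term. -/
lemma crossing_sum (f g : Fin m ⊕ Fin n → ZMod 2) :
    crossing f g = lineCrossing (fun i => f (Sum.inl i)) (fun i => g (Sum.inl i)) +
      (∑ i, f (Sum.inl i)) * (∑ j, g (Sum.inr j)) +
      lineCrossing (fun j => g (Sum.inr j)) (fun j => f (Sum.inr j)) := by
  have e1 : ∀ i i' : Fin m, tlPos m n (Sum.inl i) < tlPos m n (Sum.inl i') ↔ i < i' :=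
    fun i i' => Iff.rfl
  have e2 : ∀ (i : Fin m) (j : Fin n), tlPos m n (Sum.inl i) < tlPos m n (Sum.inr j) := by
    rintro ⟨i, hi⟩ ⟨j, hj⟩; simp only [tlPos]; omega
  have e3 : ∀ j j' : Fin n, tlPos m n (Sum.inr j) < tlPos m n (Sum.inr j') ↔ j' < j := by
    rintro ⟨j, hj⟩ ⟨j', hj'⟩; simp only [tlPos, Fin.mk_lt_mk]; omega
  simp only [crossing, lineCrossing, Fintype.sum_sum_type, e1, e2, e3, (e2 _ _).not_gt, if_true,
    if_false, Finset.sum_const_zero, zero_add, Finset.sum_add_distrib, Finset.sum_mul_sum, add_assoc]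
  congr 2
  rw [Finset.sum_comm]
  simp only [mul_comm]

lemma lineCrossing_add (u v : Fin n → ZMod 2) (h : ∀ i, u i * v i = 0) :
    lineCrossing u v + lineCrossing v u = (∑ i, u i) * ∑ i, v i := by
  rw [Finset.sum_mul_sum, lineCrossing, lineCrossing, Finset.sum_comm (f := fun i j =>
    if i < j then v i * u j else 0), ← Finset.sum_add_distrib]
  refine Finset.sum_congr rfl fun i _ => ?_
  rw [← Finset.sum_add_distrib]
  refine Finset.sum_congr rfl fun j _ => ?_
  rcases lt_trichotomy i j with hij | rfl | hij
  · simp [hij, hij.not_gt]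
  · simp [h]
  · simp [hij, hij.not_gt, mul_comm]

lemma sum_inl_eq_sum_inr (D : TLDiagram m n) (f : Fin m ⊕ Fin n → ZMod 2)
    (hf : ∀ a, f (D.link a) = f a) : ∑ i, f (Sum.inl i) = ∑ j, f (Sum.inr j) := by
  have := sum_eq_zero_of_link_invariant D f hf
  rw [Fintype.sum_sum_type] at this
  exact (CharTwo.add_eq_zero).1 this

section

variable (D₁ : TLDiagram m n) (D₂ : TLDiagram n p)

lemma outer_sum_eq_zero (F : Fin m ⊕ (Fin n ⊕ Fin p) → ZMod 2)
    (h1 : ∀ a, F (leftPt (D₁.link a)) = F (leftPt a))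
    (h2 : ∀ a, F (rightPt (D₂.link a)) = F (rightPt a)) : ∑ a, F (outerPt a) = 0 := by
  have e1 := sum_inl_eq_sum_inr D₁ (fun a => F (leftPt a)) h1
  have e2 := sum_inl_eq_sum_inr D₂ (fun a => F (rightPt a)) h2
  simp only [leftPt, rightPt] at e1 e2
  rw [Fintype.sum_sum_type]
  simp only [outerPt]
  rw [e1, e2]
  exact CharTwo.add_self_eq_zero _

/-- The crossing numbers of both factors vanish. The middle column is traversed in opposite
directions in the two, so its two contributions add up to the product of the parities of `F` and `G`
(`lineCrossing_add`), and these parities are the same on all three columns. -/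
lemma outer_crossing_eq_zero (F G : Fin m ⊕ (Fin n ⊕ Fin p) → ZMod 2)
    (hF1 : ∀ a, F (leftPt (D₁.link a)) = F (leftPt a))
    (hF2 : ∀ a, F (rightPt (D₂.link a)) = F (rightPt a))
    (hG1 : ∀ a, G (leftPt (D₁.link a)) = G (leftPt a))
    (hG2 : ∀ a, G (rightPt (D₂.link a)) = G (rightPt a))
    (hFG : ∀ x, F x * G x = 0) :
    crossing (fun a => F (outerPt a)) (fun a => G (outerPt a)) = 0 := by
  have f1 := sum_inl_eq_sum_inr D₁ (fun a => F (leftPt a)) hF1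
  have f2 := sum_inl_eq_sum_inr D₂ (fun a => F (rightPt a)) hF2
  have g1 := sum_inl_eq_sum_inr D₁ (fun a => G (leftPt a)) hG1
  have g2 := sum_inl_eq_sum_inr D₂ (fun a => G (rightPt a)) hG2
  have x1 := crossing_eq_zero D₁ _ _ hF1 hG1 fun a => hFG _
  have x2 := crossing_eq_zero D₂ _ _ hF2 hG2 fun a => hFG _
  have x3 := lineCrossing_add (fun j => F (Sum.inr (Sum.inl j))) (fun j => G (Sum.inr (Sum.inl j)))
    fun j => hFG _
  rw [crossing_sum] at x1 x2 ⊢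
  simp only [leftPt, rightPt, outerPt] at *
  rw [g1] at *
  rw [f1] at *
  rw [f2] at *
  rw [g2] at *
  have h2 : (2 : ZMod 2) = 0 := by decide
  linear_combination x1 + x2 - x3 -
    (∑ j, F (Sum.inr (Sum.inr j))) * (∑ j, G (Sum.inr (Sum.inr j))) * h2

/-- The indicator of a component is constant along edges, so a component contains an even number of
outer points; it cannot contain `a` alone. -/
lemma exists_ne_reachable (a : Fin m ⊕ Fin p) :
    ∃ b, a ≠ b ∧ (glue D₁ D₂).Reachable (outerPt a) (outerPt b) := by
  classical
  by_contra! hb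
  let F : Fin m ⊕ (Fin n ⊕ Fin p) → ZMod 2 := fun x =>
    if (glue D₁ D₂).Reachable (outerPt a) x then 1 else 0
  have key : ∀ x y, (glue D₁ D₂).Adj x y → F y = F x := fun x y h => by
    simp only [F]
    congr 1
    exact propext ⟨fun h' => h'.trans h.symm.reachable, fun h' => h'.trans h.reachable⟩
  have := outer_sum_eq_zero D₁ D₂ F (fun a => key _ _ (glue_adj_left D₁ D₂ a))
    (fun a => key _ _ (glue_adj_right D₁ D₂ a))
  rw [Finset.sum_eq_single a (fun b _ h => if_neg (hb b h.symm))
    (fun h => absurd (Finset.mem_univ a) h)] at this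
  simp at this

/-- The concatenation of two diagrams, closed loops being removed. -/
def comp : TLDiagram m p where
  link a := (exists_ne_reachable D₁ D₂ a).choose
  link_link a := by
    obtain ⟨h1, h2⟩ := (exists_ne_reachable D₁ D₂ a).choose_spec
    set b := (exists_ne_reachable D₁ D₂ a).choose
    obtain ⟨h3, h4⟩ := (exists_ne_reachable D₁ D₂ b).choose_spec
    by_contra hc
    exact not_three_outer D₁ D₂ h1 (Ne.symm hc) h3 h2 (h2.trans h4)
  link_ne a := (exists_ne_reachable D₁ D₂ a).choose_spec.1.symm
  planar a b := by
    classical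
    obtain ⟨h1, h2⟩ := (exists_ne_reachable D₁ D₂ a).choose_spec
    set a' := (exists_ne_reachable D₁ D₂ a).choose
    obtain ⟨h3, h4⟩ := (exists_ne_reachable D₁ D₂ b).choose_spec
    set b' := (exists_ne_reachable D₁ D₂ b).choose
    rintro ⟨l1, l2, l3⟩
    have ne : ∀ {x y : Fin m ⊕ Fin p}, tlPos m p x < tlPos m p y → x ≠ y := by
      rintro x _ h rfl; exact lt_irrefl _ h
    have key : ∀ c x y, (glue D₁ D₂).Adj x y →
        (if (glue D₁ D₂).Reachable (outerPt c) y then (1 : ZMod 2) else 0) =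
        if (glue D₁ D₂).Reachable (outerPt c) x then 1 else 0 := fun c x y h => by
      congr 1
      exact propext ⟨fun h' => h'.trans h.symm.reachable, fun h' => h'.trans h.reachable⟩
    -- The curves through `a` and `b` are disjoint, so their crossing number is even. In the
    -- forbidden order `a, b, a', b'` it would count the pairs `(a, b)`, `(a, b')`, `(a', b')`,
    -- which is odd.
    have h0 := outer_crossing_eq_zero D₁ D₂
      (fun x => if (glue D₁ D₂).Reachable (outerPt a) x then (1 : ZMod 2) else 0)
      (fun x => if (glue D₁ D₂).Reachable (outerPt b) x then (1 : ZMod 2) else 0)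
      (fun x => key a _ _ (glue_adj_left D₁ D₂ x)) (fun x => key a _ _ (glue_adj_right D₁ D₂ x))
      (fun x => key b _ _ (glue_adj_left D₁ D₂ x)) (fun x => key b _ _ (glue_adj_right D₁ D₂ x))
      (fun x => by
        split_ifs with r1 r2
        · exact (not_three_outer D₁ D₂ h1 (ne l1) (ne l2).symm h2 (r1.trans r2.symm)).elim
        all_goals simp)
    have ra : ∀ x, (glue D₁ D₂).Reachable (outerPt a) (outerPt x) ↔ x = a ∨ x = a' := by
      refine fun x => ⟨fun h => ?_, ?_⟩
      · by_contra! hx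
        exact not_three_outer D₁ D₂ h1 hx.1.symm hx.2.symm h2 h
      · rintro (rfl | rfl)
        exacts [SimpleGraph.Reachable.refl _, h2]
    have rb : ∀ x, (glue D₁ D₂).Reachable (outerPt b) (outerPt x) ↔ x = b ∨ x = b' := by
      refine fun x => ⟨fun h => ?_, ?_⟩
      · by_contra! hx
        exact not_three_outer D₁ D₂ h3 hx.1.symm hx.2.symm h4 h
      · rintro (rfl | rfl)
        exacts [SimpleGraph.Reachable.refl _, h4]
    simp only [crossing, ra, rb] at h0
    have e : ∀ x, (∑ y, if tlPos m p x < tlPos m p y then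
        (if x = a ∨ x = a' then (1 : ZMod 2) else 0) * (if y = b ∨ y = b' then 1 else 0) else 0) =
        (if x = a ∨ x = a' then 1 else 0) * ((if tlPos m p x < tlPos m p b then 1 else 0) +
          (if tlPos m p x < tlPos m p b' then 1 else 0)) := by
      intro x
      rw [Finset.sum_eq_add b b' h3]
      · simp; split_ifs <;> simp
      · rintro c - ⟨n1, n2⟩; simp [n1, n2]
      · simp
      · simp
    simp only [e] at h0
    rw [Finset.sum_eq_add a a' h1 (by rintro c - ⟨n1, n2⟩; simp [n1, n2]) (by simp) (by simp)] at h0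
    simp [l1, l1.trans (l2.trans l3), l3, l2.not_gt] at h0
    exact absurd h0 (by decide)

lemma comp_link_iff (a b) : (comp D₁ D₂).link a = b ↔
    a ≠ b ∧ (glue D₁ D₂).Reachable (outerPt a) (outerPt b) := by
  obtain ⟨h1, h2⟩ := (exists_ne_reachable D₁ D₂ a).choose_spec
  constructor
  · rintro rfl
    exact ⟨h1, h2⟩
  · rintro ⟨h3, h4⟩
    by_contra hc
    exact not_three_outer D₁ D₂ h1 h3 hc h2 h4

lemma isConcat_iff (D : TLDiagram m p) : IsConcat D₁ D₂ D ↔ D = comp D₁ D₂ := by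
  constructor
  · intro h
    ext a : 2
    rw [h, ← comp_link_iff]
  · rintro rfl
    exact comp_link_iff D₁ D₂

lemma compCoeff_eq (β : ℂ) (D : TLDiagram m p) :
    compCoeff β D₁ D₂ D = if D = comp D₁ D₂ then β ^ loops D₁ D₂ else 0 := by
  simp only [compCoeff, isConcat_iff]

end

end TLDiagram

end

noncomputable section

/-! ### Two-colourings: a faithful matrix model of concatenation -/

namespace TLDiagram

variable {m n p r : ℕ}

/-- A two-colouring of the points of `D` is compatible with `D` if linked points have the same
colour. -/
def Compat (D : TLDiagram m n) (s : Fin m → Bool) (t : Fin n → Bool) : Prop :=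
  ∀ a, Sum.elim s t (D.link a) = Sum.elim s t a

open Classical in
/-- The matrix that counts the compatible colourings of `D`. -/
def K (D : TLDiagram m n) : Matrix (Fin m → Bool) (Fin n → Bool) ℕ :=
  fun s t => if D.Compat s t then 1 else 0

lemma K_apply_of_compat {D : TLDiagram m n} {s t} (h : D.Compat s t) : D.K s t = 1 := if_pos h

open Classical in
lemma K_apply (D : TLDiagram m n) (s t) : D.K s t = if D.Compat s t then 1 else 0 := rfl

lemma K_apply_of_not {D : TLDiagram m n} {s t} (h : ¬ D.Compat s t) : D.K s t = 0 := if_neg h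

lemma K_apply_ne_zero {D : TLDiagram m n} {s t} : D.K s t ≠ 0 ↔ D.Compat s t := by
  simp [K]

lemma compat_iff_forall_link {D : TLDiagram m n} {s t} {x y : Fin m ⊕ Fin n}
    (h : D.Compat s t) (hxy : D.link x = y) : Sum.elim s t x = Sum.elim s t y := by
  rw [← hxy, h]

lemma exists_compat_eq (D : TLDiagram m n) (a : Fin m ⊕ Fin n) :
    ∃ s t, D.Compat s t ∧ ∀ b, Sum.elim s t b = true ↔ b = a ∨ b = D.link a := by
  refine ⟨fun i => decide (Sum.inl i = a ∨ Sum.inl i = D.link a),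
    fun i => decide (Sum.inr i = a ∨ Sum.inr i = D.link a), ?_, ?_⟩
  · have e : ∀ b, Sum.elim (fun i => decide (Sum.inl i = a ∨ Sum.inl i = D.link a))
        (fun i => decide (Sum.inr i = a ∨ Sum.inr i = D.link a)) b =
        decide (b = a ∨ b = D.link a) := by rintro (b | b) <;> rfl
    intro b
    rw [e, e]
    congr 1
    apply propext
    constructor
    · rintro (h | h)
      · right; rw [← h, D.link_link]
      · left; rw [← D.link_link b, h, D.link_link]
    · rintro (h | h)
      · right; rw [h]
      · left; rw [h, D.link_link]
  · rintro (b | b) <;> simp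

/-- Test the hypothesis on the colouring that is `true` exactly on the chord at `a`. -/
lemma link_eq_of_compat {D : TLDiagram m n} {a b : Fin m ⊕ Fin n} (hab : a ≠ b)
    (h : ∀ s t, D.Compat s t → Sum.elim s t a = Sum.elim s t b) : D.link a = b := by
  obtain ⟨s, t, h1, h2⟩ := exists_compat_eq D a
  have := h s t h1
  rw [(h2 a).2 (Or.inl rfl)] at this
  exact (((h2 b).1 this.symm).resolve_left hab.symm).symm

lemma K_injective : Function.Injective (K : TLDiagram m n → _) := by
  intro D D' h
  ext a : 2
  refine link_eq_of_compat (D'.link_ne a).symm fun s t hs => ?_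
  rw [← K_apply_ne_zero, h, K_apply_ne_zero] at hs
  exact (hs a).symm

lemma exists_K_ne_zero (D : TLDiagram m n) : D.K (fun _ => true) (fun _ => true) = 1 :=
  K_apply_of_compat fun a => by
    have : ∀ b : Fin m ⊕ Fin n, Sum.elim (fun _ => true) (fun _ => true) b = true := by
      rintro (b | b) <;> rfl
    rw [this, this]

/-- A constant colouring is compatible with every diagram, so the corresponding entry reveals the
power of 2. -/
lemma K_smul_injective {D D' : TLDiagram m n} {a b : ℕ} (h : 2 ^ a • D.K = 2 ^ b • D'.K) :
    a = b ∧ D = D' := by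
  have h1 := congrFun (congrFun h (fun _ => true)) (fun _ => true)
  simp only [Matrix.smul_apply, exists_K_ne_zero, smul_eq_mul, mul_one] at h1
  have h2 : a = b := Nat.pow_right_injective le_rfl h1
  subst h2
  refine ⟨rfl, K_injective ?_⟩
  ext s t
  have := congrFun (congrFun h s) t
  simpa using this

section

variable (D₁ : TLDiagram m n) (D₂ : TLDiagram n p)

lemma reachable_color {s : Fin m → Bool} {t : Fin n → Bool} {u : Fin p → Bool}
    (h1 : D₁.Compat s t) (h2 : D₂.Compat t u) {x y} (h : (glue D₁ D₂).Reachable x y) :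
    Sum.elim s (Sum.elim t u) x = Sum.elim s (Sum.elim t u) y := by
  have hl : ∀ a, Sum.elim s (Sum.elim t u) (leftPt a) = Sum.elim s t a := by
    rintro (a | a) <;> rfl
  obtain ⟨w⟩ := h
  induction w with
  | nil => rfl
  | cons h _ ih =>
    rw [← ih]
    rcases (glue_adj_iff D₁ D₂ _ _).1 h with ⟨a, rfl, rfl⟩ | ⟨a, rfl, rfl⟩
    · rw [hl, hl, h1]
    · exact (h2 a).symm

lemma Compat.comp {s : Fin m → Bool} {t : Fin n → Bool} {u : Fin p → Bool}
    (h1 : D₁.Compat s t) (h2 : D₂.Compat t u) : (comp D₁ D₂).Compat s u := by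
  intro a
  have hl : ∀ a : Fin m ⊕ Fin p, Sum.elim s (Sum.elim t u) (outerPt a) = Sum.elim s u a := by
    rintro (a | a) <;> rfl
  have := reachable_color D₁ D₂ h1 h2 ((comp_link_iff D₁ D₂ a _).1 rfl).2
  rw [hl, hl] at this
  exact this.symm

/-- Colourings of the middle points correspond to colourings of the components of the drawing with
prescribed values at the outer points. -/
def middleEquiv (s : Fin m → Bool) (u : Fin p → Bool) :
    {t : Fin n → Bool // D₁.Compat s t ∧ D₂.Compat t u} ≃
      {F : (glue D₁ D₂).ConnectedComponent → Bool //
        ∀ a, F ((glue D₁ D₂).connectedComponentMk (outerPt a)) = Sum.elim s u a} where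
  toFun t := ⟨fun c => c.lift (Sum.elim s (Sum.elim t.1 u))
    (fun _ _ w _ => reachable_color D₁ D₂ t.2.1 t.2.2 w.reachable), by rintro (a | a) <;> rfl⟩
  invFun F := ⟨fun j => F.1 ((glue D₁ D₂).connectedComponentMk (Sum.inr (Sum.inl j))), by
    have h1 : ∀ a, Sum.elim s (fun j => F.1 ((glue D₁ D₂).connectedComponentMk
        (Sum.inr (Sum.inl j)))) a = F.1 ((glue D₁ D₂).connectedComponentMk (leftPt a)) := by
      rintro (a | a)
      · exact (F.2 (Sum.inl a)).symm
      · rfl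
    have h2 : ∀ a, Sum.elim (fun j => F.1 ((glue D₁ D₂).connectedComponentMk
        (Sum.inr (Sum.inl j)))) u a = F.1 ((glue D₁ D₂).connectedComponentMk (rightPt a)) := by
      rintro (a | a)
      · rfl
      · exact (F.2 (Sum.inr a)).symm
    constructor
    · intro a
      rw [h1, h1, SimpleGraph.ConnectedComponent.sound (glue_adj_left D₁ D₂ a).reachable]
    · intro a
      rw [h2, h2, SimpleGraph.ConnectedComponent.sound (glue_adj_right D₁ D₂ a).reachable]⟩
  left_inv t := by ext; rfl
  right_inv F := by
    ext c
    induction c using SimpleGraph.ConnectedComponent.ind with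
    | h v =>
      rcases v with v | v | v
      · exact (F.2 (Sum.inl v)).symm
      · rfl
      · exact (F.2 (Sum.inr v)).symm

open Classical in
/-- A function with prescribed values on a set is determined by its restriction to the
complement. -/
def extensionEquiv {α β : Type*} (P : α → Prop) (F₀ : α → β) :
    {F : α → β // ∀ a, P a → F a = F₀ a} ≃ ({a // ¬ P a} → β) where
  toFun F a := F.1 a.1
  invFun g := ⟨fun a => if h : P a then F₀ a else g ⟨a, h⟩, fun a h => dif_pos h⟩
  left_inv F := by
    ext a
    by_cases h : P a
    · simp [h, F.2 a h]
    · simp [h]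
  right_inv g := by
    ext a
    simp [a.2]

/-- A compatible colouring is constant on curves. The curves that reach the outside have their
colour prescribed, consistently by `h`, and each closed loop has two free choices. -/
lemma card_middle {s : Fin m → Bool} {u : Fin p → Bool} (h : (comp D₁ D₂).Compat s u) :
    Nat.card {t : Fin n → Bool // D₁.Compat s t ∧ D₂.Compat t u} = 2 ^ loops D₁ D₂ := by
  classical
  rw [Nat.card_congr (middleEquiv D₁ D₂ s u)]
  let mk := fun a => (glue D₁ D₂).connectedComponentMk (outerPt a)
  let F₀ : (glue D₁ D₂).ConnectedComponent → Bool := fun c =>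
    if h : ∃ a, mk a = c then Sum.elim s u h.choose else false
  have hF₀ : ∀ a, F₀ (mk a) = Sum.elim s u a := by
    intro a
    have hex : ∃ b, mk b = mk a := ⟨a, rfl⟩
    simp only [F₀, dif_pos hex]
    by_cases hb : hex.choose = a
    · rw [hb]
    · have := (comp_link_iff D₁ D₂ _ _).2
        ⟨hb, SimpleGraph.ConnectedComponent.exact hex.choose_spec⟩
      rw [← h]
      rw [this]
  have e : ∀ F : (glue D₁ D₂).ConnectedComponent → Bool,
      (∀ a, F (mk a) = Sum.elim s u a) ↔ ∀ c, (∃ a, mk a = c) → F c = F₀ c := by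
    intro F
    constructor
    · rintro h _ ⟨a, rfl⟩
      rw [h, hF₀]
    · intro h a
      rw [h _ ⟨a, rfl⟩, hF₀]
  rw [Nat.card_congr (Equiv.subtypeEquivRight e), Nat.card_congr (extensionEquiv _ F₀),
    Nat.card_fun, Nat.card_eq_fintype_card, Fintype.card_bool, loops]
  simp only [not_exists, mk, ne_eq]

lemma K_mul : D₁.K * D₂.K = 2 ^ loops D₁ D₂ • (comp D₁ D₂).K := by
  classical
  ext s u
  rw [Matrix.mul_apply, Matrix.smul_apply]
  have e : ∀ t, D₁.K s t * D₂.K t u = if D₁.Compat s t ∧ D₂.Compat t u then 1 else 0 := by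
    intro t
    simp only [K]
    split_ifs <;> simp_all
  simp only [e, Finset.sum_boole, Nat.cast_id]
  rw [← Fintype.card_subtype, ← Nat.card_eq_fintype_card]
  by_cases h : (comp D₁ D₂).Compat s u
  · rw [card_middle D₁ D₂ h, K_apply_of_compat h, smul_eq_mul, mul_one]
  · have : IsEmpty {t : Fin n → Bool // D₁.Compat s t ∧ D₂.Compat t u} :=
      ⟨fun t => h (Compat.comp D₁ D₂ t.2.1 t.2.2)⟩
    simp [K, h]

lemma exists_compat_of_comp {s : Fin m → Bool} {u : Fin p → Bool}
    (h : (comp D₁ D₂).Compat s u) : ∃ t, D₁.Compat s t ∧ D₂.Compat t u := by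
  have h1 := card_middle D₁ D₂ h
  have : 0 < Nat.card {t : Fin n → Bool // D₁.Compat s t ∧ D₂.Compat t u} := by
    rw [h1]; positivity
  obtain ⟨t⟩ := (Nat.card_pos_iff.1 this).1
  exact ⟨t.1, t.2⟩

/-- The criterion used to compute compositions: compare the numbers of colourings. -/
lemma comp_eq_of_K_mul {D : TLDiagram m p} {a : ℕ} (h : D₁.K * D₂.K = 2 ^ a • D.K) :
    loops D₁ D₂ = a ∧ comp D₁ D₂ = D := by
  rw [K_mul] at h
  exact K_smul_injective h

end

/-- Associativity of the matrix product gives the equality of diagrams and the balance of loops at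
once. -/
lemma comp_assoc (D₁ : TLDiagram m n) (D₂ : TLDiagram n p) (D₃ : TLDiagram p r) :
    loops D₁ D₂ + loops (comp D₁ D₂) D₃ = loops D₂ D₃ + loops D₁ (comp D₂ D₃) ∧
      comp (comp D₁ D₂) D₃ = comp D₁ (comp D₂ D₃) := by
  apply K_smul_injective
  rw [pow_add, pow_add, mul_smul, mul_smul, ← K_mul, ← K_mul, ← Matrix.smul_mul, ← Matrix.mul_smul,
    ← K_mul, ← K_mul, Matrix.mul_assoc]

lemma compat_id {s t : Fin n → Bool} : (TLDiagram.id n).Compat s t ↔ s = t := by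
  constructor
  · intro h
    funext i
    exact (h (Sum.inr i))
  · rintro rfl (a | a) <;> rfl

lemma K_id : (TLDiagram.id n).K = 1 := by
  ext s t
  simp [K, compat_id, Matrix.one_apply]

lemma id_comp (D : TLDiagram m n) : loops (TLDiagram.id m) D = 0 ∧ comp (TLDiagram.id m) D = D :=
  comp_eq_of_K_mul _ _ (by rw [K_id]; simp)

lemma comp_id (D : TLDiagram m n) : loops D (TLDiagram.id n) = 0 ∧ comp D (TLDiagram.id n) = D :=
  comp_eq_of_K_mul _ _ (by rw [K_id]; simp)

lemma compat_reflect {D : TLDiagram m n} {s t} : D.reflect.Compat t s ↔ D.Compat s t := by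
  have e : ∀ a : Fin n ⊕ Fin m, Sum.elim t s a = Sum.elim s t a.swap := by rintro (a | a) <;> rfl
  constructor
  · intro h a
    have := h a.swap
    simpa [reflect, e] using this
  · intro h a
    have := h a.swap
    simpa [reflect, e] using this

lemma K_reflect (D : TLDiagram m n) : D.reflect.K = D.K.transpose := by
  ext s t
  rw [Matrix.transpose_apply]
  by_cases h : D.Compat t s
  · rw [K_apply_of_compat h, K_apply_of_compat (compat_reflect.2 h)]
  · rw [K_apply_of_not h, K_apply_of_not (fun h' => h (compat_reflect.1 h'))]

lemma reflect_reflect (D : TLDiagram m n) : D.reflect.reflect = D := by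
  ext a : 2
  simp [reflect]

lemma reflect_comp (D₁ : TLDiagram m n) (D₂ : TLDiagram n p) :
    loops D₂.reflect D₁.reflect = loops D₁ D₂ ∧
      comp D₂.reflect D₁.reflect = (comp D₁ D₂).reflect :=
  comp_eq_of_K_mul _ _ (by
    rw [K_reflect, K_reflect, K_reflect, ← Matrix.transpose_mul, K_mul, Matrix.transpose_smul])

lemma reflect_id (n : ℕ) : (TLDiagram.id n).reflect = TLDiagram.id n :=
  K_injective (by rw [K_reflect, K_id, Matrix.transpose_one])

lemma eq_id_of_compat {D : TLDiagram n n} (h : ∀ s t, D.Compat s t → s = t) :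
    D = TLDiagram.id n := by
  ext a : 2
  refine link_eq_of_compat (by rcases a with a | a <;> simp [TLDiagram.id]) fun s t hst => ?_
  obtain rfl := h s t hst
  rcases a with a | a <;> rfl

end TLDiagram

end

noncomputable section

/-! ### Linear combinations of diagrams -/

namespace TLDiagram

variable {m n p r : ℕ} {β : ℂ}

/-- A diagram, as a linear combination of diagrams. -/
def basis (D : TLDiagram m n) : TLDiagram m n → ℂ := Pi.single D 1

lemma basis_apply (D E : TLDiagram m n) : basis D E = if E = D then 1 else 0 := by
  simp [basis, Pi.single_apply]

lemma eq_sum_basis (x : TLDiagram m n → ℂ) : x = ∑ D, x D • basis D := by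
  ext D
  simp [basis_apply]

lemma lin_induction {P : (TLDiagram m n → ℂ) → Prop} (h0 : P 0) (h : ∀ D, P (basis D))
    (hadd : ∀ x y, P x → P y → P (x + y)) (hsmul : ∀ (c : ℂ) x, P x → P (c • x)) (x) : P x := by
  rw [eq_sum_basis x]
  exact Finset.sum_induction _ P hadd h0 fun D _ => hsmul _ _ (h D)

/-- The bilinear extension of the composition of diagrams. -/
def hMul (β : ℂ) : (TLDiagram m n → ℂ) →ₗ[ℂ] (TLDiagram n p → ℂ) →ₗ[ℂ] (TLDiagram m p → ℂ) :=
  LinearMap.mk₂ ℂ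
    (fun x y D => ∑ D₁, ∑ D₂, x D₁ * y D₂ * compCoeff β D₁ D₂ D)
    (fun x x' y => by ext; simp [add_mul, Finset.sum_add_distrib])
    (fun c x y => by ext; simp [Finset.mul_sum, mul_assoc])
    (fun x y y' => by ext; simp [mul_add, add_mul, Finset.sum_add_distrib])
    (fun c x y => by ext; simp [Finset.mul_sum, mul_assoc, mul_left_comm])

lemma hMul_apply (x : TLDiagram m n → ℂ) (y : TLDiagram n p → ℂ) (D) :
    hMul β x y D = ∑ D₁, ∑ D₂, x D₁ * y D₂ * compCoeff β D₁ D₂ D := rfl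

lemma hMul_basis (D₁ : TLDiagram m n) (D₂ : TLDiagram n p) :
    hMul β (basis D₁) (basis D₂) = β ^ loops D₁ D₂ • basis (comp D₁ D₂) := by
  ext D
  rw [hMul_apply, Finset.sum_eq_single D₁ (fun E _ h => by simp [basis_apply, h]) (by simp),
    Finset.sum_eq_single D₂ (fun E _ h => by simp [basis_apply, h]) (by simp)]
  simp [basis_apply, compCoeff_eq]

lemma hMul_assoc (x : TLDiagram m n → ℂ) (y : TLDiagram n p → ℂ) (z : TLDiagram p r → ℂ) :
    hMul β (hMul β x y) z = hMul β x (hMul β y z) := by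
  induction x using lin_induction with
  | h0 => simp
  | hadd _ _ h h' => simp only [map_add, LinearMap.add_apply, h, h']
  | hsmul _ _ h => simp only [map_smul, LinearMap.smul_apply, h]
  | h D₁ =>
  induction y using lin_induction with
  | h0 => simp
  | hadd _ _ h h' => simp only [map_add, LinearMap.add_apply, h, h']
  | hsmul _ _ h => simp only [map_smul, LinearMap.smul_apply, h]
  | h D₂ =>
  induction z using lin_induction with
  | h0 => simp
  | hadd _ _ h h' => simp only [map_add, h, h']
  | hsmul _ _ h => simp only [map_smul, h]
  | h D₃ =>
  obtain ⟨h1, h2⟩ := comp_assoc D₁ D₂ D₃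
  simp only [hMul_basis, map_smul, LinearMap.smul_apply, smul_smul, ← pow_add, h1, h2]

lemma hMul_one_left (x : TLDiagram m n → ℂ) : hMul β (basis (TLDiagram.id m)) x = x := by
  induction x using lin_induction with
  | h0 => simp
  | hadd _ _ h h' => simp only [map_add, h, h']
  | hsmul _ _ h => simp only [map_smul, h]
  | h D =>
  rw [hMul_basis, (id_comp D).1, (id_comp D).2, pow_zero, one_smul]

lemma hMul_one_right (x : TLDiagram m n → ℂ) : hMul β x (basis (TLDiagram.id n)) = x := by
  induction x using lin_induction with
  | h0 => simp
  | hadd _ _ h h' => simp only [map_add, LinearMap.add_apply, h, h']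
  | hsmul _ _ h => simp only [map_smul, LinearMap.smul_apply, h]
  | h D =>
  rw [hMul_basis, (comp_id D).1, (comp_id D).2, pow_zero, one_smul]

/-- The linear extension of the reflection of diagrams. -/
def hStar : (TLDiagram m n → ℂ) →ₗ[ℂ] (TLDiagram n m → ℂ) where
  toFun x D := x D.reflect
  map_add' _ _ := rfl
  map_smul' _ _ := rfl

lemma hStar_basis (D : TLDiagram m n) : hStar (basis D) = basis D.reflect := by
  ext E
  simp only [hStar, LinearMap.coe_mk, AddHom.coe_mk, basis_apply]
  congr 1
  apply propext
  constructor
  · rintro rfl; rw [reflect_reflect]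
  · rintro rfl; rw [reflect_reflect]

lemma hStar_hMul (x : TLDiagram m n → ℂ) (y : TLDiagram n p → ℂ) :
    hStar (hMul β x y) = hMul β (hStar y) (hStar x) := by
  induction x using lin_induction with
  | h0 => simp
  | hadd _ _ h h' => simp only [map_add, LinearMap.add_apply, h, h']
  | hsmul _ _ h => simp only [map_smul, LinearMap.smul_apply, h]
  | h D₁ =>
  induction y using lin_induction with
  | h0 => simp
  | hadd _ _ h h' => simp only [map_add, LinearMap.add_apply, h, h']
  | hsmul _ _ h => simp only [map_smul, LinearMap.smul_apply, h]
  | h D₂ =>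
  obtain ⟨h1, h2⟩ := reflect_comp D₁ D₂
  simp only [hMul_basis, map_smul, hStar_basis, h1, h2]

end TLDiagram

open TLDiagram

/-- The space `TL n`, with the ring structure of the Temperley-Lieb algebra `TL_n(β)`. -/
def TLAlg (_β : ℂ) (n : ℕ) : Type := TL n

namespace TLAlg

variable (β : ℂ) (n : ℕ)

instance : AddCommGroup (TLAlg β n) := inferInstanceAs (AddCommGroup (TL n))

instance : Module ℂ (TLAlg β n) := inferInstanceAs (Module ℂ (TL n))

instance : Ring (TLAlg β n) where
  __ := (inferInstance : AddCommGroup (TLAlg β n))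
  mul := fun (x : TL n) (y : TL n) => hMul (m := n) (n := n) (p := n) β x y
  one := tlOne n
  mul_assoc := hMul_assoc (β := β)
  one_mul := hMul_one_left (β := β)
  mul_one := hMul_one_right (β := β)
  left_distrib x y z := map_add (hMul (m := n) (n := n) (p := n) β x) y z
  right_distrib x y z := LinearMap.map_add₂ (hMul (m := n) (n := n) (p := n) β) x y z
  zero_mul x := LinearMap.map_zero₂ (hMul (m := n) (n := n) (p := n) β) x
  mul_zero x := map_zero (hMul (m := n) (n := n) (p := n) β x)

instance : Algebra ℂ (TLAlg β n) :=
  Algebra.ofModule (fun c x y => LinearMap.map_smul₂ (hMul (m := n) (n := n) (p := n) β) c x y)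
    (fun c x y => map_smul (hMul (m := n) (n := n) (p := n) β x) c y)

variable {β n}

/-- The identification of `TLAlg β n` with the linear combinations of diagrams. -/
def lin : TLAlg β n ≃ₗ[ℂ] (TLDiagram n n → ℂ) := LinearEquiv.refl ℂ (TLDiagram n n → ℂ)

lemma lin_mul (x y : TLAlg β n) : lin (x * y) = hMul β (lin x) (lin y) := rfl

lemma lin_one : lin (1 : TLAlg β n) = basis (TLDiagram.id n) := rfl

end TLAlg

/-! ### Wenzl-Jones projectors in an abstract algebra -/

section JonesWenzl

variable {R : Type*} [Ring R] [Algebra ℂ R]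

/-- The recursion of the Wenzl-Jones projectors, for elements `g` and coefficients `c`. -/
def jonesWenzl (c : ℕ → ℂ) (g : ℕ → R) : ℕ → R
  | 0 => 1
  | m + 1 => jonesWenzl c g m - c m • (jonesWenzl c g m * g m * jonesWenzl c g m)

/-- The Temperley-Lieb relations for `g 0, …, g (M - 1)`. -/
structure TLRelations (β : ℂ) (M : ℕ) (g : ℕ → R) : Prop where
  sq : ∀ i < M, g i * g i = β • g i
  up : ∀ i, i + 1 < M → g (i + 1) * g i * g (i + 1) = g (i + 1)
  comm : ∀ i j, i + 2 ≤ j → j < M → g i * g j = g j * g i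

variable {β : ℂ} {M : ℕ} {g : ℕ → R} {c a : ℕ → ℂ}

lemma jonesWenzl_commute (hg : TLRelations β M g) (m j : ℕ) (h : m + 1 ≤ j) (hj : j < M) :
    jonesWenzl c g m * g j = g j * jonesWenzl c g m := by
  induction m with
  | zero => simp [jonesWenzl]
  | succ m ih =>
    have h1 : Commute (jonesWenzl c g m) (g j) := ih (by omega)
    have h2 : Commute (g m) (g j) := hg.comm m j (by omega) hj
    exact h1.sub_left (((h1.mul_left h2).mul_left h1).smul_left (c m))

/-- All clauses are proved in one induction, driven by the third: it gives `(F g F)² = a F g F` for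
`F` the current projector and `g` the next generator, so subtracting `c F g F` with `c a = 1` leaves
an idempotent that `g` annihilates. The recursion for `a` is what sandwiching the new projector
between the generator after `g` produces. At `m = 0` the truncated `m - 1` is harmless. -/
lemma jonesWenzl_properties (hg : TLRelations β M g) (hc : ∀ i < M, c i * a i = 1)
    (ha0 : a 0 = β) (ha : ∀ i, i + 1 < M → a (i + 1) = β - c i) (m : ℕ) (hm : m ≤ M) :
    jonesWenzl c g m * jonesWenzl c g m = jonesWenzl c g m ∧
    (∀ j < m, g j * jonesWenzl c g m = 0 ∧ jonesWenzl c g m * g j = 0) ∧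
    (m < M → g m * jonesWenzl c g m * g m = a m • (jonesWenzl c g (m - 1) * g m)) ∧
    jonesWenzl c g m * jonesWenzl c g (m - 1) = jonesWenzl c g m ∧
    jonesWenzl c g (m - 1) * jonesWenzl c g m = jonesWenzl c g m := by
  induction m with
  | zero =>
    refine ⟨by simp [jonesWenzl], by simp, fun h => ?_, by simp [jonesWenzl],
      by simp [jonesWenzl]⟩
    simp [jonesWenzl, ha0, hg.sq 0 h]
  | succ m ih =>
    obtain ⟨h1, h2, h3, h4, h5⟩ := ih (by omega)
    replace h3 := h3 (by omega)
    have hE : jonesWenzl c g (m - 1) * g m = g m * jonesWenzl c g (m - 1) := by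
      rcases m with _ | m
      · simp [jonesWenzl]
      · exact jonesWenzl_commute hg _ _ (by simp) (by omega)
    have hca := hc m (by omega)
    set F := jonesWenzl c g m with hF
    set E := jonesWenzl c g (m - 1)
    have hF' : jonesWenzl c g (m + 1) = F - c m • (F * g m * F) := rfl
    have k1 : F * g m * F * g m = a m • (F * g m) := by
      rw [mul_assoc, mul_assoc, ← mul_assoc (g m), h3, mul_smul_comm, ← mul_assoc, h4]
    have k2 : F * g m * F * F = F * g m * F := by rw [mul_assoc, h1]
    have k3 : F * (F * g m * F) = F * g m * F := by rw [← mul_assoc, ← mul_assoc, h1]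
    have k4 : F * g m * F * (F * g m * F) = a m • (F * g m * F) := by
      rw [← mul_assoc, ← mul_assoc, k2, k1, smul_mul_assoc]
    have k5 : g m * (F * g m * F) = a m • (g m * F) := by
      rw [← mul_assoc, ← mul_assoc, h3, hE, smul_mul_assoc, mul_assoc, h5]
    refine ⟨?_, fun j hj => ?_, fun hm' => ?_, ?_, ?_⟩
    · rw [hF', sub_mul, mul_sub, mul_sub, h1, mul_smul_comm, mul_smul_comm, smul_mul_assoc,
        smul_mul_assoc, k2, k3, k4, smul_smul (c m) (a m), hca, one_smul, sub_self, sub_zero]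
    · rcases Nat.lt_succ_iff_lt_or_eq.1 hj with hj | rfl
      · obtain ⟨e1, e2⟩ := h2 j hj
        constructor
        · rw [hF', mul_sub, mul_smul_comm, ← mul_assoc, ← mul_assoc, e1]; simp
        · rw [hF', sub_mul, smul_mul_assoc, mul_assoc, e2]; simp
      · constructor
        · rw [hF', mul_sub, mul_smul_comm, k5, smul_smul, hca, one_smul, sub_self]
        · rw [hF', sub_mul, smul_mul_assoc, k1, smul_smul, hca, one_smul, sub_self]
    · have hcm : F * g (m + 1) = g (m + 1) * F := jonesWenzl_commute hg m (m + 1) le_rfl hm'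
      have e1 : g (m + 1) * F * g (m + 1) = β • (F * g (m + 1)) := by
        rw [← hcm, mul_assoc, hg.sq _ hm', mul_smul_comm]
      have e2 : g (m + 1) * (F * g m * F) * g (m + 1) = F * g (m + 1) := by
        calc g (m + 1) * (F * g m * F) * g (m + 1)
            = g (m + 1) * F * g m * (F * g (m + 1)) := by simp only [mul_assoc]
          _ = F * g (m + 1) * g m * (F * g (m + 1)) := by rw [← hcm]
          _ = F * g (m + 1) * g m * (g (m + 1) * F) := congrArg _ hcm
          _ = F * (g (m + 1) * g m * g (m + 1)) * F := by simp only [mul_assoc]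
          _ = F * g (m + 1) := by rw [hg.up m hm', mul_assoc, ← hcm, ← mul_assoc, h1]
      rw [hF', mul_sub, sub_mul, mul_smul_comm, smul_mul_assoc, e1, e2, ha m hm', sub_smul]
      rfl
    · change (F - c m • (F * g m * F)) * F = F - c m • (F * g m * F)
      rw [sub_mul, smul_mul_assoc, h1, k2]
    · change F * (F - c m • (F * g m * F)) = F - c m • (F * g m * F)
      rw [mul_sub, mul_smul_comm, h1, k3]

/-- Under `L` the leftmost projector of the correction term can be dropped by induction, which
exposes a generator on the left. -/
lemma jonesWenzl_apply_eq {W : Type*} [AddCommGroup W] [Module ℂ W] (L : R →ₗ[ℂ] W) (m : ℕ)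
    (hL : ∀ j < m, ∀ x, L (g j * x) = 0) (y : R) : L (jonesWenzl c g m * y) = L y := by
  induction m generalizing y with
  | zero => simp [jonesWenzl]
  | succ m ih =>
    have ih' := ih (fun j hj => hL j (by omega))
    rw [jonesWenzl, sub_mul, smul_mul_assoc, map_sub, map_smul, ih', mul_assoc, mul_assoc, ih',
      hL m (by omega), smul_zero, sub_zero]

lemma jonesWenzl_map {S : Type*} [Ring S] [Algebra ℂ S] (L : R →ₗ[ℂ] S)
    (hL : ∀ x y, L (x * y) = L x * L y) (h1 : L 1 = 1) {g' : ℕ → S} (m : ℕ)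
    (hg' : ∀ j < m, L (g j) = g' j) : L (jonesWenzl c g m) = jonesWenzl c g' m := by
  induction m with
  | zero => exact h1
  | succ m ih =>
    simp only [jonesWenzl, map_sub, map_smul, hL]
    rw [ih fun j hj => hg' j (by omega), hg' m (by omega)]

lemma jonesWenzl_antimap (L : R →ₗ[ℂ] R)
    (hL : ∀ x y, L (x * y) = L y * L x) (h1 : L 1 = 1) (m : ℕ)
    (hg' : ∀ j < m, L (g j) = g j) : L (jonesWenzl c g m) = jonesWenzl c g m := by
  induction m with
  | zero => exact h1
  | succ m ih =>
    simp only [jonesWenzl, map_sub, map_smul, hL]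
    rw [ih fun j hj => hg' j (by omega), hg' m (by omega), mul_assoc]

end JonesWenzl

end

noncomputable section

namespace TLDiagram

variable {m n p r N : ℕ} {β : ℂ}

/-! ### The generators -/

/-- Recolour the points `i` and `i + 1`. -/
def setPair (i : ℕ) (x : Fin N → Bool) (b : Bool) : Fin N → Bool :=
  fun a => if (a : ℕ) = i ∨ (a : ℕ) = i + 1 then b else x a

lemma compat_e {i : ℕ} (h : i + 1 < N) {x y : Fin N → Bool} : (e N i h).Compat x y ↔
    x ⟨i, by omega⟩ = x ⟨i + 1, h⟩ ∧ y ⟨i, by omega⟩ = y ⟨i + 1, h⟩ ∧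
      ∀ a : Fin N, (a : ℕ) ≠ i → (a : ℕ) ≠ i + 1 → x a = y a := by
  constructor
  · intro hc
    refine ⟨?_, ?_, fun a h1 h2 => ?_⟩
    · simpa [e, eLink] using (hc (Sum.inl ⟨i, by omega⟩)).symm
    · simpa [e, eLink] using (hc (Sum.inr ⟨i, by omega⟩)).symm
    · simpa [e, eLink, h1, h2] using hc (Sum.inr a)
  · rintro ⟨h1, h2, h3⟩ (⟨a, ha⟩ | ⟨a, ha⟩)
    · by_cases e1 : a = i
      · subst e1; simp [e, eLink, h1]
      by_cases e2 : a = i + 1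
      · subst e2; simp [e, eLink, h1]
      simpa [e, eLink, e1, e2] using (h3 ⟨a, ha⟩ e1 e2).symm
    · by_cases e1 : a = i
      · subst e1; simp [e, eLink, h2]
      by_cases e2 : a = i + 1
      · subst e2; simp [e, eLink, h2]
      simpa [e, eLink, e1, e2] using (h3 ⟨a, ha⟩ e1 e2)

lemma compat_e_setPair {i : ℕ} (h : i + 1 < N) {x y : Fin N → Bool}
    (hx : x ⟨i, by omega⟩ = x ⟨i + 1, h⟩) :
    (e N i h).Compat x y ↔ y = setPair i x true ∨ y = setPair i x false := by
  rw [compat_e]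
  constructor
  · rintro ⟨-, h2, h3⟩
    have : y = setPair i x (y ⟨i, by omega⟩) := by
      ext ⟨a, ha⟩
      simp only [setPair]
      by_cases e1 : a = i
      · subst e1; simp
      by_cases e2 : a = i + 1
      · subst e2; simp [h2]
      simp [e1, e2, h3 ⟨a, ha⟩ e1 e2]
    rcases hb : y ⟨i, by omega⟩ <;> rw [hb] at this
    · exact Or.inr this
    · exact Or.inl this
  · rintro (rfl | rfl) <;> refine ⟨hx, by simp [setPair], fun a e1 e2 => by simp [setPair, e1, e2]⟩

/-- The left arc of the generator forces equal colours at `i` and `i + 1`; the right arc lets the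
pair be recoloured freely. -/
lemma K_e_mul_apply {i : ℕ} (h : i + 1 < N) {τ : Type*} (M : Matrix (Fin N → Bool) τ ℕ) (x t) :
    ((e N i h).K * M) x t = if x ⟨i, by omega⟩ = x ⟨i + 1, h⟩ then
      M (setPair i x true) t + M (setPair i x false) t else 0 := by
  rw [Matrix.mul_apply]
  split_ifs with hx
  · have hne : setPair i x true ≠ setPair i x false := fun h' => by
      have := congrFun h' ⟨i, by omega⟩
      simp [setPair] at this
    rw [Finset.sum_eq_add (setPair i x true) (setPair i x false) hne ?_ (by simp) (by simp),
      K_apply_of_compat ((compat_e_setPair h hx).2 (Or.inl rfl)),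
      K_apply_of_compat ((compat_e_setPair h hx).2 (Or.inr rfl)), one_mul, one_mul]
    rintro y - ⟨h1, h2⟩
    rw [K_apply_of_not, zero_mul]
    rw [compat_e_setPair h hx]
    tauto
  · refine Finset.sum_eq_zero fun y _ => ?_
    rw [K_apply_of_not, zero_mul]
    exact fun hc => hx ((compat_e h).1 hc).1

lemma compat_setPair {i : ℕ} (h : i + 1 < N) {D : TLDiagram N p} {x t}
    (hD : D.link (Sum.inl ⟨i, by omega⟩) = Sum.inl ⟨i + 1, h⟩)
    (hx : x ⟨i, by omega⟩ = x ⟨i + 1, h⟩) (b : Bool) :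
    D.Compat (setPair i x b) t ↔ D.Compat x t := by
  have hD' : D.link (Sum.inl ⟨i + 1, h⟩) = Sum.inl ⟨i, by omega⟩ := by rw [← hD, D.link_link]
  have key : ∀ a, a ≠ Sum.inl ⟨i, by omega⟩ → a ≠ Sum.inl ⟨i + 1, h⟩ →
      Sum.elim (setPair i x b) t a = Sum.elim x t a := by
    rintro (⟨a, ha⟩ | a) h1 h2
    · have h1 : a ≠ i := fun h => h1 (by simp [h])
      have h2 : a ≠ i + 1 := fun h => h2 (by simp [h])
      simp [setPair, h1, h2]
    · rfl
  refine forall_congr' fun a => ?_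
  by_cases e1 : a = Sum.inl ⟨i, by omega⟩
  · subst e1; rw [hD]; simp [setPair, hx]
  by_cases e2 : a = Sum.inl ⟨i + 1, h⟩
  · subst e2; rw [hD']; simp [setPair, hx]
  rw [key a e1 e2, key]
  · intro h'; exact e2 (by rw [← D.link_link a, h', hD])
  · intro h'; exact e1 (by rw [← D.link_link a, h', hD'])

lemma e_comp_of_link {i : ℕ} (h : i + 1 < N) {D : TLDiagram N p}
    (hD : D.link (Sum.inl ⟨i, by omega⟩) = Sum.inl ⟨i + 1, h⟩) :
    loops (e N i h) D = 1 ∧ comp (e N i h) D = D := by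
  apply comp_eq_of_K_mul
  ext x t
  rw [K_e_mul_apply, Matrix.smul_apply]
  split_ifs with hx
  · by_cases hc : D.Compat x t
    · rw [K_apply_of_compat hc, K_apply_of_compat ((compat_setPair h hD hx _).2 hc),
        K_apply_of_compat ((compat_setPair h hD hx _).2 hc)]
      rfl
    · rw [K_apply_of_not hc, K_apply_of_not (fun h' => hc ((compat_setPair h hD hx _).1 h')),
        K_apply_of_not (fun h' => hc ((compat_setPair h hD hx _).1 h'))]
      rfl
  · rw [K_apply_of_not, smul_zero]
    exact fun hc => hx (by simpa using compat_iff_forall_link hc hD)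

lemma e_link_self {i : ℕ} (h : i + 1 < N) :
    (e N i h).link (Sum.inl ⟨i, by omega⟩) = Sum.inl ⟨i + 1, h⟩ := by
  simp [e, eLink]

lemma e_reflect {i : ℕ} (h : i + 1 < N) : (e N i h).reflect = e N i h := by
  ext (a | a) : 2 <;> simp only [e, reflect, eLink, Sum.swap_inl, Sum.swap_inr] <;>
    split_ifs <;> rfl

lemma comp_congr_of_K {D₁ : TLDiagram m n} {D₂ : TLDiagram n p} {D₃ : TLDiagram m r}
    {D₄ : TLDiagram r p} (h : D₁.K * D₂.K = D₃.K * D₄.K) :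
    loops D₁ D₂ = loops D₃ D₄ ∧ comp D₁ D₂ = comp D₃ D₄ := by
  rw [K_mul, K_mul] at h
  exact K_smul_injective h

lemma e_comm {i j : ℕ} (hij : i + 2 ≤ j) (h : i + 1 < N) (h' : j + 1 < N) :
    loops (e N i h) (e N j h') = loops (e N j h') (e N i h) ∧
      comp (e N i h) (e N j h') = comp (e N j h') (e N i h) := by
  -- The entries of the product are described by a condition symmetric in `k` and `l`, from which
  -- commutation is immediate.
  have key : ∀ {k l : ℕ} (hk : k + 1 < N) (hl : l + 1 < N) (_ : k + 2 ≤ l ∨ l + 2 ≤ k)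
      (x t : Fin N → Bool), ((e N k hk).K * (e N l hl).K) x t =
      if (x ⟨k, by omega⟩ = x ⟨k + 1, hk⟩ ∧ t ⟨k, by omega⟩ = t ⟨k + 1, hk⟩) ∧
        (x ⟨l, by omega⟩ = x ⟨l + 1, hl⟩ ∧ t ⟨l, by omega⟩ = t ⟨l + 1, hl⟩) ∧
        ∀ a : Fin N, ((a : ℕ) ≠ k ∧ (a : ℕ) ≠ k + 1) → ((a : ℕ) ≠ l ∧ (a : ℕ) ≠ l + 1) →
          x a = t a then 1 else 0 := by
    intro k l hk hl hkl x t
    rw [K_e_mul_apply]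
    have hc : ∀ b, (e N l hl).Compat (setPair k x b) t ↔
        (t ⟨k, by omega⟩ = b ∧ t ⟨k + 1, hk⟩ = b) ∧
        (x ⟨l, by omega⟩ = x ⟨l + 1, hl⟩ ∧ t ⟨l, by omega⟩ = t ⟨l + 1, hl⟩) ∧
        ∀ a : Fin N, ((a : ℕ) ≠ k ∧ (a : ℕ) ≠ k + 1) → ((a : ℕ) ≠ l ∧ (a : ℕ) ≠ l + 1) →
          x a = t a := by
      intro b
      rw [compat_e]
      have e1 : setPair k x b ⟨l, by omega⟩ = x ⟨l, by omega⟩ := by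
        simp only [setPair]; rw [if_neg (by omega)]
      have e2 : setPair k x b ⟨l + 1, hl⟩ = x ⟨l + 1, hl⟩ := by
        simp only [setPair]; rw [if_neg (by omega)]
      rw [e1, e2]
      constructor
      · rintro ⟨h1, h2, h3⟩
        have f1 := h3 ⟨k, by omega⟩ (by simp only; omega) (by simp only; omega)
        have f2 := h3 ⟨k + 1, hk⟩ (by simp only; omega) (by simp only; omega)
        simp only [setPair, true_or, or_true, if_true] at f1 f2
        refine ⟨⟨f1.symm, f2.symm⟩, ⟨h1, h2⟩, fun a g1 g2 => ?_⟩
        have := h3 a g2.1 g2.2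
        simpa [setPair, g1.1, g1.2] using this
      · rintro ⟨⟨h1, h2⟩, ⟨h3, h4⟩, h5⟩
        refine ⟨h3, h4, fun a g1 g2 => ?_⟩
        by_cases k1 : (a : ℕ) = k
        · rw [Fin.ext k1 (b := ⟨k, by omega⟩), h1]
          simp [setPair]
        by_cases k2 : (a : ℕ) = k + 1
        · rw [Fin.ext k2 (b := ⟨k + 1, by omega⟩), h2]
          simp [setPair]
        simpa [setPair, k1, k2] using h5 a ⟨k1, k2⟩ ⟨g1, g2⟩
    classical
    simp only [K_apply, hc]
    by_cases hx : x ⟨k, by omega⟩ = x ⟨k + 1, hk⟩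
    · rcases hb : t ⟨k, by omega⟩ <;> rcases hb' : t ⟨k + 1, hk⟩ <;> simp [hx]
    · simp [hx]
  apply comp_congr_of_K
  ext x t
  rw [key h h' (Or.inl hij), key h' h (Or.inr hij)]
  congr 1
  apply propext
  constructor
  · rintro ⟨h1, h2, h3⟩; exact ⟨h2, h1, fun a g1 g2 => h3 a g2 g1⟩
  · rintro ⟨h1, h2, h3⟩; exact ⟨h2, h1, fun a g1 g2 => h3 a g2 g1⟩

lemma e_e_e {i : ℕ} (h : i + 1 < N) (h' : i + 1 + 1 < N) :
    (e N i h).K * ((e N (i + 1) h').K * (e N i h).K) = (e N i h).K := by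
  ext x t
  simp only [K_e_mul_apply]
  by_cases hx : x ⟨i, by omega⟩ = x ⟨i + 1, h⟩
  · rw [if_pos hx]
    have e1 : ∀ b, setPair i x b ⟨i + 1, by omega⟩ = b := fun b => by simp [setPair]
    have e2 : ∀ b, setPair i x b ⟨i + 1 + 1, h'⟩ = x ⟨i + 1 + 1, h'⟩ := fun b => by
      simp only [setPair]; rw [if_neg (by omega)]
    -- The outer generators need equal colours at `i` and `i + 1`, and the middle one ties them to
    -- the colour at `i + 2`. Hence exactly one recolouring can contribute, and no factor 2 appears.
    have e3 : ∀ b b', (e N i h).Compat (setPair (i + 1) (setPair i x b) b') t ↔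
        b = b' ∧ (e N i h).Compat (setPair (i + 1) (setPair i x b) b) t := by
      intro b b'
      constructor
      · intro hc
        have : b = b' := by
          have := ((compat_e h).1 hc).1
          simp only [setPair, true_or, or_true, if_true] at this
          rwa [if_neg (by omega)] at this
        subst this
        exact ⟨rfl, hc⟩
      · rintro ⟨rfl, hc⟩
        exact hc
    have e4 : (e N i h).Compat (setPair (i + 1) (setPair i x (x ⟨i + 1 + 1, h'⟩))
        (x ⟨i + 1 + 1, h'⟩)) t ↔ (e N i h).Compat x t := by
      rw [compat_e, compat_e]
      refine and_congr (by simp [setPair, hx]) (and_congr Iff.rfl (forall_congr' fun a =>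
        forall_congr' fun h1 => forall_congr' fun h2 => ?_))
      by_cases h3 : (a : ℕ) = i + 1 + 1
      · obtain rfl : a = ⟨i + 1 + 1, h'⟩ := Fin.ext h3
        simp [setPair]
      · simp [setPair, h1, h2, h3]
    classical
    simp only [e1, e2, K_apply]
    simp only [e3 true false, e3 false true]
    rcases hb : x ⟨i + 1 + 1, h'⟩ <;> rw [hb] at e4 <;> simp [e4]
  · rw [if_neg hx, K_apply_of_not]
    exact fun hc => hx ((compat_e h).1 hc).1

end TLDiagram

end

noncomputable section

namespace TLDiagram

variable {m n p r N : ℕ} {β : ℂ}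

/-! ### Adding a strand on top, and closing the top strand -/

/-- The links of a diagram with one more strand on top. -/
def addTopLink (D : TLDiagram m n) : Fin (m + 1) ⊕ Fin (n + 1) → Fin (m + 1) ⊕ Fin (n + 1)
  | Sum.inl a => Fin.cases (Sum.inr 0) (fun i => Sum.map Fin.succ Fin.succ (D.link (Sum.inl i))) a
  | Sum.inr a => Fin.cases (Sum.inl 0) (fun i => Sum.map Fin.succ Fin.succ (D.link (Sum.inr i))) a

lemma addTopLink_map (D : TLDiagram m n) (a : Fin m ⊕ Fin n) :
    addTopLink D (Sum.map Fin.succ Fin.succ a) = Sum.map Fin.succ Fin.succ (D.link a) := by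
  rcases a with a | a <;> rfl

lemma sum_cases_succ {P : Fin (m + 1) ⊕ Fin (n + 1) → Prop} (h1 : P (Sum.inl 0)) (h2 : P (Sum.inr 0))
    (h : ∀ a : Fin m ⊕ Fin n, P (Sum.map Fin.succ Fin.succ a)) (a) : P a := by
  rcases a with a | a <;> induction a using Fin.cases with
  | zero => assumption
  | succ i => first | exact h (Sum.inl i) | exact h (Sum.inr i)

lemma tlPos_map_succ (a : Fin m ⊕ Fin n) :
    tlPos (m + 1) (n + 1) (Sum.map Fin.succ Fin.succ a) = tlPos m n a + 1 := by
  rcases a with ⟨a, ha⟩ | ⟨a, ha⟩ <;> simp [tlPos]; omega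

lemma tlPos_lt (a : Fin m ⊕ Fin n) : tlPos m n a < m + n := by
  rcases a with ⟨a, ha⟩ | ⟨a, ha⟩ <;> simp only [tlPos] <;> omega

/-- The diagram with one more strand on top. -/
def addTop (D : TLDiagram m n) : TLDiagram (m + 1) (n + 1) where
  link := addTopLink D
  link_link := sum_cases_succ rfl rfl fun a => by rw [addTopLink_map, addTopLink_map, D.link_link]
  link_ne := by
    refine sum_cases_succ (by simp [addTopLink]) (by simp [addTopLink]) fun a h => ?_
    rw [addTopLink_map] at h
    exact D.link_ne a (Sum.map_injective.2 ⟨Fin.succ_injective _, Fin.succ_injective _⟩ h)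
  planar := by
    have e1 : tlPos (m + 1) (n + 1) (Sum.inl 0) = 0 := rfl
    have e2 : tlPos (m + 1) (n + 1) (Sum.inr 0) = m + n + 1 := by simp [tlPos]; omega
    have e3 : addTopLink D (Sum.inl 0) = Sum.inr 0 := rfl
    have e4 : addTopLink D (Sum.inr 0) = Sum.inl 0 := rfl
    refine sum_cases_succ ?_ ?_ fun a => ?_ <;> refine sum_cases_succ ?_ ?_ fun b => ?_ <;>
      simp only [e1, e2, e3, e4, addTopLink_map, tlPos_map_succ]
    · omega
    · omega
    · have := tlPos_lt b; have := tlPos_lt (D.link b); omega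
    · omega
    · omega
    · omega
    · omega
    · have := tlPos_lt a; have := tlPos_lt (D.link a); omega
    · have := D.planar a b; omega

lemma compat_addTop {D : TLDiagram m n} {b b' : Bool} {s t} :
    (addTop D).Compat (Fin.cons b s) (Fin.cons b' t) ↔ b = b' ∧ D.Compat s t := by
  have e : ∀ a, Sum.elim (Fin.cons b s : Fin (m + 1) → Bool) (Fin.cons b' t : Fin (n + 1) → Bool)
      (Sum.map Fin.succ Fin.succ a) = Sum.elim s t a := by rintro (a | a) <;> rfl
  constructor
  · intro h
    refine ⟨(h (Sum.inr 0)), fun a => ?_⟩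
    have := h (Sum.map Fin.succ Fin.succ a)
    change Sum.elim _ _ (addTopLink D _) = _ at this
    rwa [addTopLink_map, e, e] at this
  · rintro ⟨rfl, h⟩
    refine sum_cases_succ rfl rfl fun a => ?_
    change Sum.elim _ _ (addTopLink D _) = _
    rw [addTopLink_map, e, e, h]

lemma K_addTop (D : TLDiagram m n) (b b' : Bool) (s t) :
    (addTop D).K (Fin.cons b s) (Fin.cons b' t) = if b = b' then D.K s t else 0 := by
  classical
  simp only [K_apply, compat_addTop]
  by_cases b = b' <;> simp [*]

lemma sum_bool_cons {M : Type*} [AddCommMonoid M] (f : (Fin (n + 1) → Bool) → M) :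
    ∑ x, f x = ∑ b : Bool, ∑ s : Fin n → Bool, f (Fin.cons b s) := by
  rw [← Fintype.sum_prod_type']
  exact (Fintype.sum_equiv (Fin.consEquiv fun _ => Bool) _ _ fun _ => rfl).symm

lemma matrix_ext_cons {A B : Matrix (Fin (m + 1) → Bool) (Fin (n + 1) → Bool) ℕ}
    (h : ∀ b b' s t, A (Fin.cons b s) (Fin.cons b' t) = B (Fin.cons b s) (Fin.cons b' t)) :
    A = B := by
  ext x y
  rw [← Fin.cons_self_tail x, ← Fin.cons_self_tail y]
  exact h _ _ _ _

lemma addTop_comp (D₁ : TLDiagram m n) (D₂ : TLDiagram n p) :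
    loops (addTop D₁) (addTop D₂) = loops D₁ D₂ ∧
      comp (addTop D₁) (addTop D₂) = addTop (comp D₁ D₂) := by
  apply comp_eq_of_K_mul
  apply matrix_ext_cons
  intro b b' s t
  have h := congrFun (congrFun (K_mul D₁ D₂) s) t
  rw [Matrix.smul_apply, Matrix.mul_apply] at h
  rw [Matrix.smul_apply, Matrix.mul_apply, sum_bool_cons, K_addTop]
  simp only [K_addTop, Fintype.sum_bool]
  rcases b <;> rcases b' <;> simp [h]

lemma addTop_id (n : ℕ) : addTop (TLDiagram.id n) = TLDiagram.id (n + 1) := by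
  ext a : 2
  revert a
  refine sum_cases_succ rfl rfl fun a => ?_
  exact (addTopLink_map _ a).trans (by rcases a with a | a <;> rfl)

lemma addTop_e {i : ℕ} (h : i + 1 < N) : addTop (e N i h) = e (N + 1) (i + 1) (by omega) := by
  ext a : 2
  revert a
  refine sum_cases_succ (by simp [addTop, addTopLink, e, eLink])
    (by simp [addTop, addTopLink, e, eLink]) fun a => ?_
  refine (addTopLink_map _ a).trans ?_
  rcases a with a | a <;> simp only [e, eLink, Sum.map_inl, Sum.map_inr, Fin.val_succ,
    Nat.add_right_cancel_iff] <;> split_ifs <;> rfl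

/-- The links of the diagram that only links the two top points on the left. -/
def capTopLink (N : ℕ) : Fin (N + 2) ⊕ Fin N → Fin (N + 2) ⊕ Fin N
  | Sum.inl a => Fin.cases (Sum.inl 1) (fun i => Fin.cases (Sum.inl 0) (fun j => Sum.inr j) i) a
  | Sum.inr a => Sum.inl a.succ.succ

lemma capTop_cases {P : Fin (N + 2) ⊕ Fin N → Prop} (h1 : P (Sum.inl 0)) (h2 : P (Sum.inl 1))
    (h3 : ∀ i : Fin N, P (Sum.inl i.succ.succ)) (h4 : ∀ i, P (Sum.inr i)) (a) : P a := by
  rcases a with a | a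
  · induction a using Fin.cases with
    | zero => exact h1
    | succ a =>
      induction a using Fin.cases with
      | zero => exact h2
      | succ a => exact h3 a
  · exact h4 a

/-- The diagram that links the two top points on the left and the others to the right. -/
def capTop (N : ℕ) : TLDiagram (N + 2) N where
  link := capTopLink N
  link_link := capTop_cases rfl rfl (fun _ => rfl) (fun _ => rfl)
  link_ne := capTop_cases (by simp [capTopLink])
    (by rw [show capTopLink N (Sum.inl 1) = Sum.inl 0 from rfl]; simp) (fun i => by simp [capTopLink])
    (fun i => by simp [capTopLink])
  planar := by
    have e1 : capTopLink N (Sum.inl 0) = Sum.inl 1 := rfl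
    have e2 : capTopLink N (Sum.inl 1) = Sum.inl 0 := rfl
    have e3 : ∀ i, capTopLink N (Sum.inr i) = Sum.inl i.succ.succ := fun i => rfl
    have e4 : ∀ i : Fin N, capTopLink N (Sum.inl i.succ.succ) = Sum.inr i := fun i => rfl
    refine capTop_cases ?_ ?_ (fun i => ?_) (fun i => ?_) <;>
      refine capTop_cases ?_ ?_ (fun j => ?_) (fun j => ?_) <;>
      simp only [e1, e2, e3, e4, tlPos, Fin.val_succ, Fin.val_zero, Fin.val_one] <;> omega

lemma compat_capTop {x : Fin (N + 2) → Bool} {s : Fin N → Bool} : (capTop N).Compat x s ↔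
    x = Fin.cons true (Fin.cons true s) ∨ x = Fin.cons false (Fin.cons false s) := by
  constructor
  · intro h
    have h1 : x 1 = x 0 := h (Sum.inl 0)
    have h2 : ∀ i : Fin N, x i.succ.succ = s i := fun i => h (Sum.inr i)
    have : x = Fin.cons (x 0) (Fin.cons (x 0) s) := by
      ext i
      induction i using Fin.cases with
      | zero => rfl
      | succ i =>
        induction i using Fin.cases with
        | zero => simpa using h1
        | succ i => simpa using h2 i
    rcases hx : x 0 <;> rw [hx] at this
    · exact Or.inr this
    · exact Or.inl this
  · rintro (rfl | rfl) <;> exact capTop_cases rfl rfl (fun _ => rfl) (fun _ => rfl)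

lemma sum_K_capTop (f : (Fin (N + 2) → Bool) → ℕ) (s : Fin N → Bool) :
    ∑ x, (capTop N).K x s * f x = ∑ b : Bool, f (Fin.cons b (Fin.cons b s)) := by
  have hne : (Fin.cons true (Fin.cons true s) : Fin (N + 2) → Bool) ≠
      Fin.cons false (Fin.cons false s) := fun h => by simpa using congrFun h 0
  rw [Finset.sum_eq_add _ _ hne ?_ (by simp) (by simp),
    K_apply_of_compat (compat_capTop.2 (Or.inl rfl)),
    K_apply_of_compat (compat_capTop.2 (Or.inr rfl)), Fintype.sum_bool, one_mul, one_mul]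
  rintro y - ⟨h1, h2⟩
  rw [K_apply_of_not, zero_mul]
  rw [compat_capTop]
  tauto

/-- Closing the top strand of a diagram gives a diagram, possibly with a loop. -/
lemma exists_closeTop (E : TLDiagram (N + 1) (N + 1)) : ∃ (a : ℕ) (E' : TLDiagram N N),
    ∀ s t, ∑ b : Bool, E.K (Fin.cons b s) (Fin.cons b t) = 2 ^ a * E'.K s t := by
  -- An extra strand above `E`, capped with the top strand of `E` on both sides, serves as the
  -- closing arc.
  refine ⟨loops (addTop E) (capTop N) + loops (capTop N).reflect (comp (addTop E) (capTop N)),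
    comp (capTop N).reflect (comp (addTop E) (capTop N)), fun s t => ?_⟩
  have h : (capTop N).reflect.K * ((addTop E).K * (capTop N).K) =
      2 ^ (loops (addTop E) (capTop N) +
        loops (capTop N).reflect (comp (addTop E) (capTop N))) •
      (comp (capTop N).reflect (comp (addTop E) (capTop N))).K := by
    rw [K_mul, Matrix.mul_smul, K_mul, smul_smul, pow_add]
  have h := congrFun (congrFun h s) t
  rw [Matrix.smul_apply, smul_eq_mul] at h
  rw [← h, Matrix.mul_apply]
  simp only [K_reflect, Matrix.transpose_apply, sum_K_capTop]
  simp only [Matrix.mul_apply, mul_comm ((addTop E).K _ _), sum_K_capTop, K_addTop,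
    Fintype.sum_bool]
  simp

/-! ### The trace -/

/-- Closing the strands one at a time from the top turns the matrix trace into a power of 2; its
exponent serves as the number of loops of the closure. -/
lemma exists_trace_K (D : TLDiagram N N) : ∃ a, Matrix.trace D.K = 2 ^ a := by
  induction N with
  | zero =>
    refine ⟨0, ?_⟩
    rw [Matrix.trace, Fintype.sum_unique, Matrix.diag_apply,
      K_apply_of_compat (by rintro (a | a) <;> exact a.elim0), pow_zero]
  | succ N ih =>
    obtain ⟨a, E, h⟩ := exists_closeTop D
    obtain ⟨b, hb⟩ := ih E
    refine ⟨a + b, ?_⟩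
    rw [Matrix.trace, sum_bool_cons, Finset.sum_comm]
    simp only [Matrix.diag_apply, h]
    rw [← Finset.mul_sum, pow_add, ← hb]
    rfl

/-- The number of loops of the closure of a diagram. -/
def closureLoops (D : TLDiagram N N) : ℕ := (exists_trace_K D).choose

lemma trace_K (D : TLDiagram N N) : Matrix.trace D.K = 2 ^ closureLoops D :=
  (exists_trace_K D).choose_spec

/-- The trace: each loop of the closure of a diagram gives a factor `β`. -/
def hTrace (β : ℂ) : (TLDiagram N N → ℂ) →ₗ[ℂ] ℂ where
  toFun x := ∑ D, x D * β ^ closureLoops D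
  map_add' x y := by simp [add_mul, Finset.sum_add_distrib]
  map_smul' c x := by simp [Finset.mul_sum, mul_assoc]

lemma hTrace_basis (D : TLDiagram N N) : hTrace β (basis D) = β ^ closureLoops D := by
  simp [hTrace, basis_apply]

lemma trace_K_mul (D₁ : TLDiagram m n) (D₂ : TLDiagram n m) :
    Matrix.trace (D₁.K * D₂.K) = 2 ^ (loops D₁ D₂ + closureLoops (comp D₁ D₂)) := by
  rw [K_mul, Matrix.trace_smul, trace_K, smul_eq_mul, pow_add]

lemma hTrace_hMul_basis (D₁ : TLDiagram m n) (D₂ : TLDiagram n m) :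
    hTrace β (hMul β (basis D₁) (basis D₂)) =
      β ^ (loops D₁ D₂ + closureLoops (comp D₁ D₂)) := by
  rw [hMul_basis, map_smul, hTrace_basis, smul_eq_mul, pow_add]

lemma hTrace_comm (x : TLDiagram m n → ℂ) (y : TLDiagram n m → ℂ) :
    hTrace β (hMul β x y) = hTrace β (hMul β y x) := by
  induction x using lin_induction with
  | h0 => simp
  | hadd _ _ h h' => simp only [map_add, LinearMap.add_apply, h, h']
  | hsmul _ _ h => simp only [map_smul, LinearMap.smul_apply, h]
  | h D₁ =>
  induction y using lin_induction with
  | h0 => simp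
  | hadd _ _ h h' => simp only [map_add, LinearMap.add_apply, h, h']
  | hsmul _ _ h => simp only [map_smul, LinearMap.smul_apply, h]
  | h D₂ =>
  rw [hTrace_hMul_basis, hTrace_hMul_basis]
  congr 1
  -- The loop numbers are compared through the powers of 2 that are traces of colouring matrices,
  -- where cyclicity is known.
  apply Nat.pow_right_injective le_rfl
  simp only [← trace_K_mul, Matrix.trace_mul_comm D₁.K]

/-- The linear extension of adding a strand on top. -/
def hAddTop : (TLDiagram m n → ℂ) →ₗ[ℂ] (TLDiagram (m + 1) (n + 1) → ℂ) where
  toFun x := ∑ D, x D • basis (addTop D)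
  map_add' x y := by simp [add_smul, Finset.sum_add_distrib]
  map_smul' c x := by simp [Finset.smul_sum, mul_smul]

lemma hAddTop_basis (D : TLDiagram m n) : hAddTop (basis D) = basis (addTop D) := by
  simp [hAddTop, basis_apply]

lemma hAddTop_hMul (x : TLDiagram m n → ℂ) (y : TLDiagram n p → ℂ) :
    hAddTop (hMul β x y) = hMul β (hAddTop x) (hAddTop y) := by
  induction x using lin_induction with
  | h0 => simp
  | hadd _ _ h h' => simp only [map_add, LinearMap.add_apply, h, h']
  | hsmul _ _ h => simp only [map_smul, LinearMap.smul_apply, h]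
  | h D₁ =>
  induction y using lin_induction with
  | h0 => simp
  | hadd _ _ h h' => simp only [map_add, h, h']
  | hsmul _ _ h => simp only [map_smul, h]
  | h D₂ =>
  simp only [hMul_basis, hAddTop_basis, map_smul, (addTop_comp D₁ D₂).1, (addTop_comp D₁ D₂).2]

/-- The partial trace: an element that leaves the top strand straight passes through the closing of
that strand, so only `E` has to be closed there. -/
lemma hTrace_hAddTop (x : TLDiagram N N → ℂ) {E : TLDiagram (N + 1) (N + 1)} {a : ℕ}
    {E' : TLDiagram N N}
    (h : ∀ s t, ∑ b : Bool, E.K (Fin.cons b s) (Fin.cons b t) = 2 ^ a * E'.K s t) :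
    hTrace β (hMul β (hAddTop x) (basis E)) = β ^ a * hTrace β (hMul β x (basis E')) := by
  induction x using lin_induction with
  | h0 => simp
  | hadd _ _ h h' => simp only [map_add, LinearMap.add_apply, h, h', mul_add]
  | hsmul _ _ h => simp only [map_smul, LinearMap.smul_apply, h, smul_eq_mul, mul_left_comm]
  | h D =>
  rw [hAddTop_basis, hTrace_hMul_basis, hTrace_hMul_basis, ← pow_add]
  congr 1
  apply Nat.pow_right_injective le_rfl
  simp only [pow_add 2 a, ← trace_K_mul, Matrix.trace, Matrix.diag_apply, Matrix.mul_apply]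
  simp only [sum_bool_cons (n := N), K_addTop, Finset.mul_sum]
  rw [Finset.sum_comm]
  refine Finset.sum_congr rfl fun s _ => ?_
  simp only [Fintype.sum_bool, if_true, Bool.true_eq_false, Bool.false_eq_true, if_false, zero_mul,
    Finset.sum_const_zero, add_zero, zero_add]
  rw [← Finset.sum_add_distrib]
  refine Finset.sum_congr rfl fun t _ => ?_
  have := h t s
  rw [Fintype.sum_bool] at this
  rw [← mul_add, this]
  ring

end TLDiagram

end

noncomputable section

open TLDiagram

/-! ### The Wenzl-Jones projectors -/

lemma loopWeight_mul_qNum (q : ℂ) (hq : q ≠ 0) (m : ℕ) :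
    loopWeight q * qNum q (m + 1) = qNum q (m + 2) + qNum q m := by
  have h : q * q⁻¹ = 1 := mul_inv_cancel₀ hq
  simp only [loopWeight, qNum, ← add_div, ← mul_div_assoc]
  congr 1
  linear_combination (q ^ m - (q⁻¹) ^ m) * h

lemma qNum_zero (q : ℂ) : qNum q 0 = 0 := by simp [qNum]

lemma qNum_one {q : ℂ} (h : q - q⁻¹ ≠ 0) : qNum q 1 = 1 := by simp [qNum, div_self h]

lemma qNum_two {q : ℂ} (hq : q ≠ 0) (h : q - q⁻¹ ≠ 0) : qNum q 2 = loopWeight q := by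
  have := loopWeight_mul_qNum q hq 0
  rw [qNum_zero, qNum_one h] at this
  simpa using this.symm

/-- The coefficients of the recursion of the Wenzl-Jones projectors. -/
def wjCoeff (q : ℂ) (m : ℕ) : ℂ := qNum q (m + 1) / qNum q (m + 2)

/-- The generators of `TL_N(β)`, numbered from the bottom. -/
def tlGen (β : ℂ) (N j : ℕ) : TLAlg β N := TLAlg.lin.symm (tlE N (N - (j + 2)))

/-- The Wenzl-Jones projector on the `k` bottom points. -/
def wjProj (q : ℂ) (N k : ℕ) : TLDiagram N N → ℂ :=
  TLAlg.lin (jonesWenzl (wjCoeff q) (tlGen (loopWeight q) N) (k - 1))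

lemma wenzlJones_eq (q : ℂ) (N k : ℕ) : wenzlJones q N k = wjProj q N k := by
  rcases k with _ | k
  · rfl
  induction k with
  | zero => rfl
  | succ k ih =>
    have h : wenzlJones q N (k + 2) = wenzlJones q N (k + 1) - (qNum q (k + 1) / qNum q (k + 2)) •
      tlMul (loopWeight q) (tlMul (loopWeight q) (wenzlJones q N (k + 1)) (tlE N (N - (k + 2))))
        (wenzlJones q N (k + 1)) := rfl
    rw [h, ih]
    rfl

lemma lin_tlGen (β : ℂ) {N i j : ℕ} (h : i + 1 < N) (hij : i + (j + 2) = N) :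
    TLAlg.lin (tlGen β N j) = basis (e N i h) := by
  rw [tlGen, LinearEquiv.apply_symm_apply, show N - (j + 2) = i by omega, tlE, dif_pos h]
  rfl

lemma tlGen_relations (β : ℂ) (N : ℕ) : TLRelations β (N - 1) (tlGen β N) where
  sq j hj := by
    obtain ⟨i, hi⟩ : ∃ i, i + (j + 2) = N := ⟨N - (j + 2), by omega⟩
    have h : i + 1 < N := by omega
    obtain ⟨e1, e2⟩ := e_comp_of_link h (e_link_self h)
    apply TLAlg.lin.injective
    rw [TLAlg.lin_mul, map_smul, lin_tlGen β h hi, hMul_basis, e1, e2, pow_one]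
  up j hj := by
    obtain ⟨i, hi⟩ : ∃ i, i + (j + 1 + 2) = N := ⟨N - (j + 1 + 2), by omega⟩
    have h : i + 1 < N := by omega
    have h' : i + 1 + 1 < N := by omega
    have key := e_e_e h h'
    rw [K_mul, Matrix.mul_smul, K_mul, smul_smul, ← pow_add] at key
    obtain ⟨k1, k2⟩ := K_smul_injective (key.trans (one_smul ℕ _).symm : _ = 2 ^ 0 • _)
    apply TLAlg.lin.injective
    rw [mul_assoc, TLAlg.lin_mul, TLAlg.lin_mul, lin_tlGen β h hi,
      lin_tlGen β h' (show i + 1 + (j + 2) = N by omega), hMul_basis, map_smul, hMul_basis,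
      smul_smul, ← pow_add, k1, k2, pow_zero, one_smul]
  comm j j' hjj hj' := by
    obtain ⟨i, hi⟩ : ∃ i, i + (j + 2) = N := ⟨N - (j + 2), by omega⟩
    obtain ⟨i', hi'⟩ : ∃ i, i + (j' + 2) = N := ⟨N - (j' + 2), by omega⟩
    have h : i + 1 < N := by omega
    have h' : i' + 1 < N := by omega
    obtain ⟨k1, k2⟩ := e_comm (show i' + 2 ≤ i by omega) h' h
    apply TLAlg.lin.injective
    rw [TLAlg.lin_mul, TLAlg.lin_mul, lin_tlGen β h hi, lin_tlGen β h' hi', hMul_basis, hMul_basis,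
      k1, k2]

lemma TLRelations.mono {R : Type*} [Ring R] [Algebra ℂ R] {β : ℂ} {M M' : ℕ} {g : ℕ → R}
    (h : TLRelations β M g) (hM : M' ≤ M) : TLRelations β M' g where
  sq i hi := h.sq i (by omega)
  up i hi := h.up i (by omega)
  comm i j hij hj := h.comm i j hij (by omega)

/-- The assumptions on `q` under which the projector `P_k` is defined. -/
structure WJAdmissible (q : ℂ) (k : ℕ) : Prop where
  ne_zero : q ≠ 0
  sub_ne_zero : q - q⁻¹ ≠ 0
  qNum_ne_zero : ∀ j, 1 ≤ j → j ≤ k → qNum q j ≠ 0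

lemma WJAdmissible.mono {q : ℂ} {k d : ℕ} (hq : WJAdmissible q k) (h : d ≤ k) :
    WJAdmissible q d :=
  ⟨hq.1, hq.2, fun j h1 h2 => hq.3 j h1 (h2.trans h)⟩

lemma WJAdmissible.loopWeight_ne_zero {q : ℂ} {k : ℕ} (hq : WJAdmissible q k) (h2 : 2 ≤ k) :
    loopWeight q ≠ 0 := by
  rw [← qNum_two hq.ne_zero hq.sub_ne_zero]
  exact hq.qNum_ne_zero 2 (by norm_num) h2

variable {q : ℂ} {N k p m n : ℕ}

lemma jonesWenzl_tlGen (hq : WJAdmissible q k) (hk : k ≤ N) :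
    jonesWenzl (wjCoeff q) (tlGen (loopWeight q) N) (k - 1) *
      jonesWenzl (wjCoeff q) (tlGen (loopWeight q) N) (k - 1) =
      jonesWenzl (wjCoeff q) (tlGen (loopWeight q) N) (k - 1) ∧
    ∀ j < k - 1, tlGen (loopWeight q) N j *
        jonesWenzl (wjCoeff q) (tlGen (loopWeight q) N) (k - 1) = 0 ∧
      jonesWenzl (wjCoeff q) (tlGen (loopWeight q) N) (k - 1) * tlGen (loopWeight q) N j = 0 := by
  -- With `a m = [m+2]/[m+1]`, the recursion for `a` is `β[m+2] = [m+3] + [m+1]`. The index is `k -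
  -- 1` because `P_k` uses the `k - 1` bottom generators.
  have h := jonesWenzl_properties ((tlGen_relations (loopWeight q) N).mono (M' := k - 1) (by omega))
    (c := wjCoeff q) (a := fun m => qNum q (m + 2) / qNum q (m + 1))
    (fun i hi => by
      have h1 := hq.qNum_ne_zero (i + 1) (by omega) (by omega)
      have h2 := hq.qNum_ne_zero (i + 2) (by omega) (by omega)
      simp only [wjCoeff]
      field_simp)
    (by
      simp only [zero_add]
      rw [qNum_one hq.sub_ne_zero, div_one, qNum_two hq.ne_zero hq.sub_ne_zero])
    (fun i hi => by
      have h2 := hq.qNum_ne_zero (i + 2) (by omega) (by omega)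
      have h3 := loopWeight_mul_qNum q hq.ne_zero (i + 1)
      simp only [wjCoeff]
      field_simp
      linear_combination -h3) (k - 1) le_rfl
  exact ⟨h.1, h.2.1⟩

lemma wjProj_idem (hq : WJAdmissible q k) (hk : k ≤ N) :
    hMul (loopWeight q) (wjProj q N k) (wjProj q N k) = wjProj q N k := by
  rw [wjProj, ← TLAlg.lin_mul, (jonesWenzl_tlGen hq hk).1]

lemma hStar_wjProj (hk : k ≤ N) : hStar (wjProj q N k) = wjProj q N k := by
  let L : TLAlg (loopWeight q) N →ₗ[ℂ] TLAlg (loopWeight q) N :=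
    TLAlg.lin.symm.toLinearMap ∘ₗ hStar ∘ₗ TLAlg.lin.toLinearMap
  have h := jonesWenzl_antimap (c := wjCoeff q) (g := tlGen (loopWeight q) N) L
    (fun x y => by
      apply TLAlg.lin.injective
      simp [L, TLAlg.lin_mul, hStar_hMul])
    (by
      apply TLAlg.lin.injective
      simp [L, TLAlg.lin_one, hStar_basis, reflect_id]) (k - 1)
    (fun j hj => by
      apply TLAlg.lin.injective
      simp [L, lin_tlGen _ (show N - (j + 2) + 1 < N by omega)
        (show N - (j + 2) + (j + 2) = N by omega), hStar_basis, e_reflect])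
  simpa [L, wjProj] using congrArg TLAlg.lin h

lemma hMul_wjProj_e (hq : WJAdmissible q k) (hk : k ≤ N) {i : ℕ} (h : i + 1 < N)
    (hi : N ≤ k + i) :
    hMul (loopWeight q) (wjProj q N k) (basis (e N i h)) = 0 := by
  have := ((jonesWenzl_tlGen hq hk).2 (N - (i + 2)) (by omega)).2
  rw [wjProj, ← lin_tlGen (loopWeight q) h (show i + (N - (i + 2) + 2) = N by omega),
    ← TLAlg.lin_mul, this, map_zero]

/-- Up to multiples of the generators, a Wenzl-Jones projector is the identity. -/
lemma wjProj_apply_eq {W : Type*} [AddCommGroup W] [Module ℂ W] (hk : k ≤ N)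
    (L : (TLDiagram N N → ℂ) →ₗ[ℂ] W)
    (hL : ∀ (i : ℕ) (h : i + 1 < N), N ≤ k + i → ∀ x,
      L (hMul (loopWeight q) (basis (e N i h)) x) = 0) :
    L (wjProj q N k) = L (basis (TLDiagram.id N)) := by
  have := jonesWenzl_apply_eq (c := wjCoeff q) (g := tlGen (loopWeight q) N)
    (L ∘ₗ TLAlg.lin.toLinearMap) (k - 1) (fun j hj x => by
      simp [TLAlg.lin_mul, lin_tlGen _ (show N - (j + 2) + 1 < N by omega)
        (show N - (j + 2) + (j + 2) = N by omega), hL _ _ (show N ≤ k + (N - (j + 2)) by omega)]) 1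
  rw [mul_one] at this
  exact this

/-- An innermost arc under the given one joins neighbours. The search descends to the arc at `i +
1`, which planarity keeps under the arc from `i` to `j`. -/
lemma exists_adjacent_link (D : TLDiagram N p) {i j : ℕ} (hj : j < N) (hij : i < j)
    (h : D.link (Sum.inl ⟨i, by omega⟩) = Sum.inl ⟨j, hj⟩) :
    ∃ (l : ℕ) (hl : l + 1 < N), i ≤ l ∧ D.link (Sum.inl ⟨l, by omega⟩) = Sum.inl ⟨l + 1, hl⟩ := by
  induction hs : j - i using Nat.strong_induction_on generalizing i j with
  | _ s ih =>
  by_cases h1 : j = i + 1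
  · subst h1
    exact ⟨i, hj, le_rfl, h⟩
  have e1 : tlPos N p (Sum.inl ⟨i, by omega⟩) = i := rfl
  have e2 : tlPos N p (Sum.inl ⟨j, hj⟩) = j := rfl
  have e3 : tlPos N p (Sum.inl ⟨i + 1, by omega⟩) = i + 1 := rfl
  have p1 := D.planar (Sum.inl ⟨i, by omega⟩) (Sum.inl ⟨i + 1, by omega⟩)
  have p2 := D.planar (D.link (Sum.inl ⟨i + 1, by omega⟩)) (Sum.inl ⟨i, by omega⟩)
  rw [D.link_link] at p2
  rw [h, e1, e2, e3] at p1 p2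
  have ne1 : D.link (Sum.inl ⟨i + 1, by omega⟩) ≠ Sum.inl ⟨i, by omega⟩ := fun h' => by
    rw [← h', D.link_link] at h
    simp at h; omega
  have ne2 : D.link (Sum.inl ⟨i + 1, by omega⟩) ≠ Sum.inl ⟨j, hj⟩ := fun h' => by
    rw [← h] at h'
    have := D.link_link (Sum.inl ⟨i + 1, by omega⟩)
    rw [h', D.link_link] at this
    simp at this
  have ne3 := D.link_ne (Sum.inl ⟨i + 1, by omega⟩)
  rcases hb : D.link (Sum.inl ⟨i + 1, by omega⟩) with ⟨b, hb'⟩ | ⟨b, hb'⟩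
  · rw [hb] at ne1 ne2 ne3 p1 p2
    have e4 : tlPos N p (Sum.inl ⟨b, hb'⟩) = b := rfl
    rw [e4] at p1 p2
    simp only [ne_eq, Sum.inl.injEq, Fin.mk.injEq] at ne1 ne2 ne3
    obtain ⟨l, hl, h2, h3⟩ := ih (b - (i + 1)) (by omega) hb' (by omega) hb rfl
    exact ⟨l, hl, by omega, h3⟩
  · rw [hb] at p1
    have e4 : tlPos N p (Sum.inr ⟨b, hb'⟩) = N + p - 1 - b := rfl
    omega

/-- An arc between two of the bottom `k` points encloses or is an arc between neighbours `l`, `l +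
1`. Then `β D = E D` for the generator `E` at `l`, which `P_k` annihilates, and β is invertible. -/
lemma hMul_wjProj_basis_eq_zero (hq : WJAdmissible q k) (hβ : loopWeight q ≠ 0) (hk : k ≤ N)
    {D : TLDiagram N p} {i j : Fin N} (hi : N ≤ k + i) (hj : N ≤ k + j)
    (h : D.link (Sum.inl i) = Sum.inl j) :
    hMul (loopWeight q) (wjProj q N k) (basis D) = 0 := by
  have : ∃ (l : ℕ) (hl : l + 1 < N), N ≤ k + l ∧
      D.link (Sum.inl ⟨l, by omega⟩) = Sum.inl ⟨l + 1, hl⟩ := by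
    rcases lt_trichotomy i j with hij | hij | hij
    · obtain ⟨l, hl, h3, h4⟩ := exists_adjacent_link D j.2 hij h
      exact ⟨l, hl, by omega, h4⟩
    · subst hij
      exact absurd h (D.link_ne _)
    · obtain ⟨l, hl, h3, h4⟩ := exists_adjacent_link D i.2 hij (by rw [← h, D.link_link])
      exact ⟨l, hl, by omega, h4⟩
  obtain ⟨l, hl, h3, h4⟩ := this
  obtain ⟨e1, e2⟩ := e_comp_of_link hl h4
  have e3 := hMul_basis (β := loopWeight q) (e N l hl) D
  rw [e1, e2, pow_one] at e3
  have e4 := hMul_assoc (β := loopWeight q) (wjProj q N k) (basis (e N l hl)) (basis D)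
  rw [hMul_wjProj_e hq hk hl h3, e3, map_smul, map_zero, LinearMap.zero_apply] at e4
  exact (smul_eq_zero.1 e4.symm).resolve_left hβ

lemma hAddTop_wjProj (hk : k ≤ N) : hAddTop (wjProj q N k) = wjProj q (N + 1) k := by
  let L : TLAlg (loopWeight q) N →ₗ[ℂ] TLAlg (loopWeight q) (N + 1) :=
    TLAlg.lin.symm.toLinearMap ∘ₗ hAddTop ∘ₗ TLAlg.lin.toLinearMap
  have h := jonesWenzl_map (c := wjCoeff q) (g := tlGen (loopWeight q) N)
    (g' := tlGen (loopWeight q) (N + 1)) L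
    (fun x y => by
      apply TLAlg.lin.injective
      simp [L, TLAlg.lin_mul, hAddTop_hMul])
    (by
      apply TLAlg.lin.injective
      simp [L, TLAlg.lin_one, hAddTop_basis, addTop_id]) (k - 1)
    (fun j hj => by
      apply TLAlg.lin.injective
      simp [L, lin_tlGen _ (show N - (j + 2) + 1 < N by omega)
        (show N - (j + 2) + (j + 2) = N by omega), hAddTop_basis, addTop_e,
        lin_tlGen _ (show N - (j + 2) + 1 + 1 < N + 1 by omega)
        (show N - (j + 2) + 1 + (j + 2) = N + 1 by omega)])
  simpa [L, wjProj] using congrArg TLAlg.lin h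

lemma closeTop_id (N : ℕ) (s t : Fin N → Bool) :
    ∑ b : Bool, (TLDiagram.id (N + 1)).K (Fin.cons b s) (Fin.cons b t) =
      2 ^ 1 * (TLDiagram.id N).K s t := by
  simp [K_id, Matrix.one_apply]

lemma closeTop_e (N : ℕ) (s t : Fin (N + 1) → Bool) :
    ∑ b : Bool, (e (N + 2) 0 (by omega)).K (Fin.cons b s) (Fin.cons b t) =
      2 ^ 0 * (TLDiagram.id (N + 1)).K s t := by
  classical
  have h : ∀ b, (e (N + 2) 0 (by omega)).Compat (Fin.cons b s) (Fin.cons b t) ↔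
      b = s 0 ∧ s = t := by
    intro b
    rw [compat_e]
    change b = s 0 ∧ b = t 0 ∧ _ ↔ _
    constructor
    · rintro ⟨h1, h2, h3⟩
      refine ⟨h1, ?_⟩
      ext i
      induction i using Fin.cases with
      | zero => rw [← h1, ← h2]
      | succ i => simpa using h3 i.succ.succ (by simp) (by simp)
    · rintro ⟨rfl, rfl⟩
      refine ⟨rfl, rfl, fun a h1 _ => ?_⟩
      rfl
  simp only [K_apply, h, compat_id]
  by_cases hst : s = t
  · subst hst; rcases s 0 <;> simp
  · simp [hst]

lemma hTrace_id (β : ℂ) (N : ℕ) : hTrace β (basis (TLDiagram.id N)) = β ^ N := by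
  rw [hTrace_basis]
  congr 1
  apply Nat.pow_right_injective le_rfl
  simp only [← trace_K, K_id, Matrix.trace_one]
  simp

lemma wjProj_succ (q : ℂ) (k : ℕ) : wjProj q (k + 2) (k + 2) = wjProj q (k + 2) (k + 1) -
    wjCoeff q k • hMul (loopWeight q) (hMul (loopWeight q) (wjProj q (k + 2) (k + 1))
      (basis (e (k + 2) 0 (by omega)))) (wjProj q (k + 2) (k + 1)) := by
  rw [← lin_tlGen (loopWeight q) (show 0 + 1 < k + 2 by omega) (show 0 + (k + 2) = k + 2 by omega)]
  rfl

/-- Take the partial trace of the recursion: the free strand of the first term gives a loop, and the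
generator in the second term closes up to a straight strand without a loop. The inductive step is
`β[k+2] - [k+1] = [k+3]`. -/
lemma hTrace_wjProj (hq : WJAdmissible q k) :
    hTrace (loopWeight q) (wjProj q k k) = qNum q (k + 1) := by
  rcases k with _ | k
  · exact (hTrace_id _ 0).trans (by rw [pow_zero, qNum_one hq.sub_ne_zero])
  induction k with
  | zero => exact (hTrace_id _ 1).trans (by rw [pow_one, qNum_two hq.ne_zero hq.sub_ne_zero])
  | succ k ih =>
    have hq' := hq.mono (show k + 1 ≤ k + 1 + 1 by omega)
    specialize ih hq'
    have h1 : wjProj q (k + 2) (k + 1) = hAddTop (wjProj q (k + 1) (k + 1)) :=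
      (hAddTop_wjProj le_rfl).symm
    have h3 : hTrace (loopWeight q) (wjProj q (k + 2) (k + 1)) = loopWeight q * qNum q (k + 2) := by
      rw [h1, ← hMul_one_right (β := loopWeight q) (hAddTop _),
        hTrace_hAddTop _ (closeTop_id (k + 1)), hMul_one_right, ih, pow_one]
    have h5 : hTrace (loopWeight q) (hMul (loopWeight q) (hMul (loopWeight q)
        (wjProj q (k + 2) (k + 1)) (basis (e (k + 2) 0 (by omega)))) (wjProj q (k + 2) (k + 1))) =
        qNum q (k + 2) := by
      rw [hTrace_comm, ← hMul_assoc, wjProj_idem hq' (by omega), h1,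
        hTrace_hAddTop _ (closeTop_e k), hMul_one_right, ih, pow_zero, one_mul]
    have h6 := hq.qNum_ne_zero (k + 2) (by omega) (by omega)
    rw [wjProj_succ, map_sub, map_smul, h3, h5, wjCoeff, smul_eq_mul, div_mul_cancel₀ _ h6,
      loopWeight_mul_qNum q hq.ne_zero]
    ring

end

noncomputable section

open TLDiagram

variable {q β : ℂ} {N k p m n d : ℕ}

/-! ### Links inherited by a composite, and recognition of the identity -/

namespace TLDiagram

/-- If every left point goes to the right, planarity makes the assignment strictly increasing, and
the only strictly increasing self-map of `Fin N` is the identity. -/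
lemma eq_id_or_exists_link (D : TLDiagram N N) :
    D = TLDiagram.id N ∨ ∃ i j : Fin N, D.link (Sum.inl i) = Sum.inl j := by
  by_cases hD : ∃ i j : Fin N, D.link (Sum.inl i) = Sum.inl j
  · exact Or.inr hD
  left
  push Not at hD
  have hf : ∀ i, ∃ j, D.link (Sum.inl i) = Sum.inr j := by
    intro i
    rcases h : D.link (Sum.inl i) with j | j
    · exact absurd h (hD i j)
    · exact ⟨j, rfl⟩
  choose f hf using hf
  have hmono : StrictMono f := by
    intro i j hij
    have hne : f i ≠ f j := fun h => hij.ne (Sum.inl_injective (by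
      rw [← D.link_link (Sum.inl i), ← D.link_link (Sum.inl j), hf, hf, h]))
    have := D.planar (Sum.inl i) (Sum.inl j)
    rw [hf, hf] at this
    simp only [tlPos] at this
    omega
  have hid : f = id := (hmono.range_inj strictMono_id).1 (by
    rw [(Finite.injective_iff_surjective.1 hmono.injective).range_eq, Set.range_id])
  subst hid
  ext (a | a) : 2
  · exact hf a
  · change D.link (Sum.inr a) = Sum.inl a
    rw [← D.link_link (Sum.inl a), hf]
    rfl

lemma comp_link_left {D₁ : TLDiagram m n} (D₂ : TLDiagram n p) {i j : Fin m}
    (h : D₁.link (Sum.inl i) = Sum.inl j) : (comp D₁ D₂).link (Sum.inl i) = Sum.inl j := by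
  refine link_eq_of_compat (fun h' => D₁.link_ne (Sum.inl i) ?_) fun s t hst => ?_
  · rw [h, Sum.inl_injective h']
  · obtain ⟨x, h1, -⟩ := exists_compat_of_comp D₁ D₂ hst
    simpa using compat_iff_forall_link h1 h

lemma comp_link_right (D₁ : TLDiagram m n) {D₂ : TLDiagram n p} {i j : Fin p}
    (h : D₂.link (Sum.inr i) = Sum.inr j) : (comp D₁ D₂).link (Sum.inr i) = Sum.inr j := by
  refine link_eq_of_compat (fun h' => D₂.link_ne (Sum.inr i) ?_) fun s t hst => ?_
  · rw [h, Sum.inr_injective h']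
  · obtain ⟨x, -, h1⟩ := exists_compat_of_comp D₁ D₂ hst
    simpa using compat_iff_forall_link h1 h

lemma comp_link_through {D₁ : TLDiagram m n} {D₂ : TLDiagram n p} {i j : Fin m} {a b : Fin n}
    (hi : D₁.link (Sum.inl i) = Sum.inr a) (hab : D₂.link (Sum.inl a) = Sum.inl b)
    (hj : D₁.link (Sum.inl j) = Sum.inr b) : (comp D₁ D₂).link (Sum.inl i) = Sum.inl j := by
  refine link_eq_of_compat (fun h' => ?_) fun s t hst => ?_
  · rw [Sum.inl_injective h', hj] at hi
    exact D₂.link_ne _ (by rw [hab, Sum.inr_injective hi])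
  · obtain ⟨x, h1, h2⟩ := exists_compat_of_comp D₁ D₂ hst
    exact (compat_iff_forall_link h1 hi).trans
      ((compat_iff_forall_link h2 hab).trans (compat_iff_forall_link h1 hj).symm)

lemma hMul_apply_id_eq_zero_of_link {D : TLDiagram m n} {i j : Fin m}
    (h : D.link (Sum.inl i) = Sum.inl j) (y : TLDiagram n m → ℂ) :
    hMul β (basis D) y (TLDiagram.id m) = 0 := by
  induction y using lin_induction with
  | h0 => simp
  | hadd _ _ h h' => simp only [map_add, Pi.add_apply, h, h', add_zero]
  | hsmul _ _ h => simp only [map_smul, Pi.smul_apply, h, smul_zero]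
  | h E =>
    rw [hMul_basis, Pi.smul_apply, basis_apply, if_neg, smul_zero]
    intro h'
    have := comp_link_left E h
    rw [← h'] at this
    exact absurd this (by simp [TLDiagram.id])

end TLDiagram

/-! ### Traces of multiples of the projectors -/

/-- A compatible colouring of `D` that takes the same values on the two sides at the top `N - k`
points does so at all points. -/
def ClosesToId (k : ℕ) (D : TLDiagram N N) : Prop :=
  ∀ x y, D.Compat x y → (∀ a : Fin N, a + k < N → x a = y a) → x = y

/-- Close the `N - k` top strands one by one. The remaining diagram on `k` strands is the identity,
with trace `[k+1]`, or has an arc killed by `P_k`. `ClosesToId` is inherited at each closure and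
excludes the second case at the end, so `c` is then a power of β. -/
lemma exists_hTrace_wjProj_basis (hq : WJAdmissible q k) (hβ : loopWeight q ≠ 0) (hk : k ≤ N)
    (D : TLDiagram N N) :
    ∃ c, hTrace (loopWeight q) (hMul (loopWeight q) (wjProj q N k) (basis D)) =
      c * qNum q (k + 1) ∧ (ClosesToId k D → c ≠ 0) := by
  obtain ⟨n, rfl⟩ := Nat.exists_eq_add_of_le hk
  clear hk
  induction n with
  | zero =>
    change TLDiagram k k at D
    change ∃ c, hTrace (loopWeight q) (hMul (loopWeight q) (wjProj q k k) (basis D)) = _ ∧ _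
    by_cases hD : D = TLDiagram.id k
    · subst hD
      exact ⟨1, by rw [hMul_one_right, one_mul]; exact hTrace_wjProj hq, fun _ => one_ne_zero⟩
    · obtain ⟨i, j, hij⟩ := (eq_id_or_exists_link D).resolve_left hD
      refine ⟨0, ?_, fun h => absurd (eq_id_of_compat fun x y hxy => h x y hxy fun a ha => ?_) hD⟩
      · rw [hMul_wjProj_basis_eq_zero hq hβ le_rfl (by simp) (by simp) hij]
        simp
      · omega
  | succ n ih =>
    obtain ⟨a, E, hE⟩ := exists_closeTop (N := k + n) D
    obtain ⟨c, hc, hc'⟩ := ih E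
    refine ⟨loopWeight q ^ a * c, ?_, fun h => mul_ne_zero (pow_ne_zero _ hβ) (hc' ?_)⟩
    · rw [mul_assoc, ← hc, ← hTrace_hAddTop _ hE, hAddTop_wjProj (by omega)]
      rfl
    · intro s t hst htop
      have h1 : ∑ b : Bool, D.K (Fin.cons b s) (Fin.cons b t) ≠ 0 := by
        rw [hE, K_apply_of_compat hst]
        positivity
      obtain ⟨b, -, hb⟩ := Finset.exists_ne_zero_of_sum_ne_zero h1
      have h2 := h _ _ (K_apply_ne_zero.1 hb) fun a ha => by
        induction a using Fin.cases with
        | zero => rfl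
        | succ a =>
          simp only [Fin.cons_succ]
          exact htop a (by simp at ha; omega)
      exact (Fin.cons_injective2 h2).2

lemma hTrace_wjProj_hMul_eq_zero (hq : WJAdmissible q k) (hβ : loopWeight q ≠ 0) (hk : k ≤ N)
    (h0 : qNum q (k + 1) = 0) (y : TLDiagram N N → ℂ) :
    hTrace (loopWeight q) (hMul (loopWeight q) (wjProj q N k) y) = 0 := by
  induction y using lin_induction with
  | h0 => simp
  | hadd _ _ h h' => simp only [map_add, h, h', add_zero]
  | hsmul _ _ h => simp only [map_smul, h, smul_zero]
  | h D =>
    obtain ⟨c, hc, -⟩ := exists_hTrace_wjProj_basis hq hβ hk D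
    rw [hc, h0, mul_zero]

/-- Every diagram on `d` strands other than the identity has an arc on its left side and is killed
by `P_d`. -/
lemma hTrace_wjProj_hMul_self (hq : WJAdmissible q d) (hβ : loopWeight q ≠ 0)
    (y : TLDiagram d d → ℂ) :
    hTrace (loopWeight q) (hMul (loopWeight q) (wjProj q d d) y) =
      y (TLDiagram.id d) * qNum q (d + 1) := by
  induction y using lin_induction with
  | h0 => simp
  | hadd _ _ h h' => simp only [map_add, h, h', Pi.add_apply, add_mul]
  | hsmul _ _ h => simp only [map_smul, h, Pi.smul_apply, smul_eq_mul, mul_assoc]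
  | h D =>
    rw [basis_apply]
    by_cases hD : D = TLDiagram.id d
    · subst hD
      rw [hMul_one_right, hTrace_wjProj hq, if_pos rfl, one_mul]
    · obtain ⟨i, j, hij⟩ := (eq_id_or_exists_link D).resolve_left hD
      rw [hMul_wjProj_basis_eq_zero hq hβ le_rfl (by simp) (by simp) hij, if_neg (Ne.symm hD)]
      simp

/-- The value of the form, up to a factor, is a trace over `TL_N`. -/
lemma form_mul_qNum (hqd : WJAdmissible q d) (hβ : loopWeight q ≠ 0) (P : TLDiagram N N → ℂ)
    (v w : TLDiagram N d → ℂ) :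
    hMul (loopWeight q) (hStar v) (hMul (loopWeight q) P w) (TLDiagram.id d) * qNum q (d + 1) =
      hTrace (loopWeight q) (hMul (loopWeight q) P (hMul (loopWeight q) w
        (hMul (loopWeight q) (wjProj q d d) (hStar v)))) := by
  rw [← hTrace_wjProj_hMul_self hqd hβ, ← hMul_assoc, hTrace_comm, hMul_assoc]

/-- The inequality `d < k` is needed to cancel `[d+1]`, which is among the nonzero numbers `[1], …,
[k]`. -/
lemma form_eq_zero (hq : WJAdmissible q k) (hβ : loopWeight q ≠ 0) (hk : k ≤ N) (hd : d < k)
    (h0 : qNum q (k + 1) = 0) (v w : TLDiagram N d → ℂ) :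
    hMul (loopWeight q) (hStar v) (hMul (loopWeight q) (wjProj q N k) w) (TLDiagram.id d) = 0 := by
  have h := form_mul_qNum (hq.mono hd.le) hβ (wjProj q N k) v w
  rw [hTrace_wjProj_hMul_eq_zero hq hβ hk h0] at h
  exact (mul_eq_zero.1 h).resolve_right (hq.qNum_ne_zero (d + 1) (by omega) (by omega))

/-! ### A diagram on which the form does not vanish -/

/-- The defects of `W` are at the bottom, and no link of `W` joins two of the `k` bottom points. -/
structure IsTestDiagram (k : ℕ) (W : TLDiagram N d) : Prop where
  le : d ≤ N
  defect : ∀ (i : Fin N) (j : Fin d), (i : ℕ) + d = N + j → W.link (Sum.inl i) = Sum.inr j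
  arc : ∀ i j : Fin N, W.link (Sum.inl i) = Sum.inl j → i + k < N ∨ j + k < N

lemma IsTestDiagram.link_inr {W : TLDiagram N d} (h : IsTestDiagram k W) (j : Fin d) :
    W.link (Sum.inr j) = Sum.inl ⟨N - d + j, by have := h.le; omega⟩ := by
  rw [← h.defect ⟨N - d + j, by have := h.le; omega⟩ j (by have := h.le; simp only; omega),
    W.link_link]

/-- The links of a diagram with `m` nested arcs above `r` nested arcs above `d` defects. -/
def nestLink (m r d : ℕ) (h : 2 * m + 2 * r + d = N) : Fin N ⊕ Fin d → Fin N ⊕ Fin d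
  | Sum.inl a => if h1 : (a : ℕ) < 2 * m then Sum.inl ⟨2 * m - 1 - a, by omega⟩
      else if h2 : (a : ℕ) < 2 * m + 2 * r then Sum.inl ⟨4 * m + 2 * r - 1 - a, by omega⟩
      else Sum.inr ⟨a - (2 * m + 2 * r), by omega⟩
  | Sum.inr b => Sum.inl ⟨b + (2 * m + 2 * r), by omega⟩

/-- The diagram with `m` nested arcs above `r` nested arcs above `d` defects. -/
def nestDiagram (m r d : ℕ) (h : 2 * m + 2 * r + d = N) : TLDiagram N d where
  link := nestLink m r d h
  link_link := by
    rintro (⟨a, ha⟩ | ⟨a, ha⟩)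
    · by_cases h1 : a < 2 * m
      · simp only [nestLink, h1, dif_pos]
        rw [dif_pos (by omega)]
        simp; omega
      by_cases h2 : a < 2 * m + 2 * r
      · simp only [nestLink, h1, h2, dif_pos, dif_neg, not_false_eq_true]
        rw [dif_neg (by omega), dif_pos (by omega)]
        simp; omega
      · simp only [nestLink, h1, h2, dif_neg, not_false_eq_true]
        simp; omega
    · simp only [nestLink]
      rw [dif_neg (by omega), dif_neg (by omega)]
      simp
  link_ne := by
    rintro (⟨a, ha⟩ | ⟨a, ha⟩) <;> simp only [nestLink] <;> (try split_ifs) <;> simp <;> omega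
  planar := by
    rintro (⟨a, ha⟩ | ⟨a, ha⟩) (⟨b, hb⟩ | ⟨b, hb⟩) <;> simp only [nestLink] <;> (try split_ifs) <;>
      simp only [tlPos] <;> omega

lemma exists_isTestDiagram (hd : d ∈ seamDelta n k) :
    ∃ W : TLDiagram (n + k) d, IsTestDiagram k W := by
  obtain ⟨h1, h2, h3⟩ := hd
  have h2 : d % 2 = (n + k) % 2 := h2
  -- For `d < k` the bottom `k` points are the `d` defects and the lower ends of `k - d` nested
  -- arcs; room for their upper ends is the condition `n + d ≥ k`. For `d ≥ k` the truncated `k - d`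
  -- is 0 and all bottom `k` points are defects.
  obtain ⟨m, hm⟩ : ∃ m, 2 * m + 2 * (k - d) + d = n + k :=
    ⟨(n + k - d - 2 * (k - d)) / 2, by omega⟩
  refine ⟨nestDiagram m (k - d) d hm, h1, ?_, ?_⟩
  · rintro ⟨i, hi⟩ ⟨j, hj⟩ hij
    simp only at hij
    simp only [nestDiagram, nestLink]
    rw [dif_neg (by omega), dif_neg (by omega)]
    simp; omega
  · rintro ⟨i, hi⟩ ⟨j, hj⟩ hij
    simp only [nestDiagram, nestLink] at hij
    split_ifs at hij <;> simp at hij <;> simp only <;> omega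

/-- A defect of `W` is joined straight to its mirror image, so the two sides agree there. Every arc
has an end among the top `N - k` points, where agreement is assumed, and it carries this colour to
its other end. -/
lemma IsTestDiagram.closesToId {W : TLDiagram N d} (h : IsTestDiagram k W) :
    ClosesToId k (comp W W.reflect) := by
  intro x y hxy htop
  obtain ⟨t, h1, h2⟩ := exists_compat_of_comp _ _ hxy
  rw [compat_reflect] at h2
  ext a
  rcases ha : W.link (Sum.inl a) with j | j
  · have e1 := compat_iff_forall_link h1 ha
    have e2 := compat_iff_forall_link h2 ha
    simp only [Sum.elim_inl] at e1 e2
    rcases h.arc a j ha with h3 | h3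
    · rw [htop a h3]
    · rw [e1, e2, htop j h3]
  · exact (compat_iff_forall_link h1 ha).trans (compat_iff_forall_link h2 ha).symm

lemma IsTestDiagram.form_ne_zero_of_lt {W : TLDiagram N d} (h : IsTestDiagram k W)
    (hq : WJAdmissible q k) (hβ : loopWeight q ≠ 0) (hk : k ≤ N) (hd : d < k)
    (h0 : qNum q (k + 1) ≠ 0) :
    hMul (loopWeight q) (hStar (basis W)) (hMul (loopWeight q) (wjProj q N k) (basis W))
      (TLDiagram.id d) ≠ 0 := by
  intro hz
  have h1 := form_mul_qNum (hq.mono hd.le) hβ (wjProj q N k) (basis W) (basis W)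
  let L : (TLDiagram d d → ℂ) →ₗ[ℂ] ℂ := hTrace (loopWeight q) ∘ₗ
    hMul (loopWeight q) (wjProj q N k) ∘ₗ hMul (loopWeight q) (basis W) ∘ₗ
    (hMul (loopWeight q)).flip (hStar (basis W))
  -- `P_d` can be replaced by the identity: any other term puts a generator next to `W`, which joins
  -- two defects. These lie among the bottom `k` points as `d < k`, so `P_k` kills the result.
  have h2 := wjProj_apply_eq (q := q) (le_refl d) L fun i hi _ x => by
    simp only [L, LinearMap.comp_apply, LinearMap.flip_apply]
    have e1 : W.link (Sum.inl ⟨N - d + i, by omega⟩) = Sum.inr ⟨i, by omega⟩ :=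
      h.defect _ _ (by simp only; omega)
    have e2 : W.link (Sum.inl ⟨N - d + (i + 1), by omega⟩) = Sum.inr ⟨i + 1, hi⟩ :=
      h.defect _ _ (by simp only; omega)
    rw [hMul_assoc, ← hMul_assoc _ (basis (e d i hi)), hMul_basis, map_smul, LinearMap.smul_apply,
      map_smul, ← hMul_assoc, hMul_wjProj_basis_eq_zero hq hβ hk (by simp only; omega)
        (by simp only; omega) (comp_link_through e1 (e_link_self hi) e2)]
    simp
  simp only [L, LinearMap.comp_apply, LinearMap.flip_apply] at h2
  obtain ⟨c, hc, hc'⟩ := exists_hTrace_wjProj_basis hq hβ hk (comp W W.reflect)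
  rw [hz, zero_mul, h2, hMul_one_left, hStar_basis, hMul_basis, map_smul, map_smul, hc,
    smul_eq_mul] at h1
  exact mul_ne_zero (pow_ne_zero _ hβ) (mul_ne_zero (hc' h.closesToId) h0) h1.symm

lemma IsTestDiagram.form_ne_zero_of_le {W : TLDiagram N d} (h : IsTestDiagram k W)
    (hβ : loopWeight q ≠ 0) (hk : k ≤ N) (hd : k ≤ d) :
    hMul (loopWeight q) (hStar (basis W)) (hMul (loopWeight q) (wjProj q N k) (basis W))
      (TLDiagram.id d) ≠ 0 := by
  have hle := h.le
  let L : (TLDiagram N N → ℂ) →ₗ[ℂ] ℂ := LinearMap.proj (TLDiagram.id d) ∘ₗ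
    hMul (loopWeight q) (hStar (basis W)) ∘ₗ (hMul (loopWeight q)).flip (basis W)
  -- Here `P_k` can be replaced by the identity: its generators touch only defects of `W`, as `k ≤
  -- d`, so they create an arc on the left side of the product with `W^*`, and the identity cannot
  -- occur.
  have h2 := wjProj_apply_eq (q := q) hk L fun i hi hik x => by
    simp only [L, LinearMap.comp_apply, LinearMap.flip_apply, LinearMap.proj_apply]
    have e1 : W.reflect.link (Sum.inl ⟨i - (N - d), by omega⟩) = Sum.inr ⟨i, by omega⟩ := by
      simp [reflect, h.link_inr]; omega
    have e2 : W.reflect.link (Sum.inl ⟨i + 1 - (N - d), by omega⟩) = Sum.inr ⟨i + 1, hi⟩ := by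
      simp [reflect, h.link_inr]; omega
    rw [hMul_assoc, ← hMul_assoc, hStar_basis, hMul_basis, map_smul, LinearMap.smul_apply,
      Pi.smul_apply, hMul_apply_id_eq_zero_of_link (comp_link_through e1 (e_link_self hi) e2),
      smul_zero]
  simp only [L, LinearMap.comp_apply, LinearMap.flip_apply, LinearMap.proj_apply] at h2
  have h3 : comp W.reflect W = TLDiagram.id d := eq_id_of_compat fun s t hst => by
    obtain ⟨x, h4, h5⟩ := exists_compat_of_comp _ _ hst
    rw [compat_reflect] at h4
    ext j
    exact (compat_iff_forall_link h4 (h.link_inr j)).trans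
      (compat_iff_forall_link h5 (h.link_inr j)).symm
  rw [h2, hMul_one_left, hStar_basis, hMul_basis, h3, Pi.smul_apply, basis_apply, if_pos rfl,
    smul_eq_mul, mul_one]
  exact pow_ne_zero _ hβ

/-! ### The form of the seam module -/

lemma stdAct_single (β : ℂ) (x : TL n) (w : MonicDiagram n d) :
    stdAct β x (Pi.single w 1) = fun u => hMul (m := n) (n := n) β x (basis w.1) u.1 := by
  ext u
  rw [stdAct, hMul_apply]
  refine Finset.sum_congr rfl fun D _ => ?_
  rw [Finset.sum_eq_single w (fun v _ h => by simp [h]) (by simp),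
    Finset.sum_eq_single w.1 (fun v _ h => by simp [basis_apply, h]) (by simp)]
  simp [basis_apply]

lemma compCoeff_reflect_eq_zero_of_left {D E : TLDiagram n d} (hD : ¬ D.IsMonic) :
    compCoeff β D.reflect E (TLDiagram.id d) = 0 := by
  rw [compCoeff_eq, if_neg]
  intro h
  simp only [IsMonic, not_forall, not_exists] at hD
  obtain ⟨j, hj⟩ := hD
  rcases hi : D.link (Sum.inr j) with i | i
  · exact hj i hi
  · have := comp_link_left (D₁ := D.reflect) E (i := j) (j := i) (by simp [reflect, hi])
    rw [← h] at this
    simp [TLDiagram.id] at this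

lemma compCoeff_reflect_eq_zero_of_right {D E : TLDiagram n d} (hE : ¬ E.IsMonic) :
    compCoeff β D.reflect E (TLDiagram.id d) = 0 := by
  rw [compCoeff_eq, if_neg]
  intro h
  simp only [IsMonic, not_forall, not_exists] at hE
  obtain ⟨j, hj⟩ := hE
  rcases hi : E.link (Sum.inr j) with i | i
  · exact hj i hi
  · have := comp_link_right D.reflect hi
    rw [← h] at this
    simp [TLDiagram.id] at this

/-- A non-monic factor leaves an arc on an outer side of the composite and never produces the
identity. Discarding non-monic diagrams in the standard module therefore does not affect the form.
-/
lemma stdForm_restrict (β : ℂ) (a b : TLDiagram n d → ℂ) :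
    stdForm β n d (fun v => a v.1) (fun w => b w.1) = hMul β (hStar a) b (TLDiagram.id d) := by
  have hstd : stdForm β n d (fun v => a v.1) (fun w => b w.1) =
      ∑ v : MonicDiagram n d, ∑ w : MonicDiagram n d,
        a v.1 * b w.1 * compCoeff β v.1.reflect w.1 (TLDiagram.id d) := rfl
  let r : TLDiagram n d ≃ TLDiagram d n := ⟨reflect, reflect, reflect_reflect, reflect_reflect⟩
  rw [hstd, hMul_apply, ← r.sum_comp]
  have hr : ∀ D, hStar a (r D) = a D := fun D => by simp [hStar, r, reflect_reflect]
  have key : ∀ f : TLDiagram n d → ℂ, (∀ D, ¬ D.IsMonic → f D = 0) →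
      ∑ v : MonicDiagram n d, f v.1 = ∑ D, f D := by
    classical
    intro f hf
    rw [← Finset.sum_filter_of_ne (p := IsMonic) fun D _ h => not_not.1 fun hD => h (hf D hD)]
    exact (Finset.sum_subtype _ (fun D => by simp) f).symm
  simp only [hr]
  rw [← key]
  · refine Finset.sum_congr rfl fun v _ => ?_
    exact key (fun w => a v.1 * b w * compCoeff β v.1.reflect w (TLDiagram.id d)) fun D hD => by
      rw [compCoeff_reflect_eq_zero_of_right hD, mul_zero]
  · intro D hD
    refine Finset.sum_eq_zero fun E _ => ?_
    change _ * compCoeff β D.reflect E _ = 0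
    rw [compCoeff_reflect_eq_zero_of_left hD, mul_zero]

/-- The two projectors merge because `P_k^* P_k = P_k`. -/
lemma stdForm_wenzlJones (hq : WJAdmissible q k) (v w : MonicDiagram (n + k) d) :
    stdForm (loopWeight q) (n + k) d
      (stdAct (loopWeight q) (wenzlJones q (n + k) k) (Pi.single v 1))
      (stdAct (loopWeight q) (wenzlJones q (n + k) k) (Pi.single w 1)) =
    hMul (loopWeight q) (hStar (basis v.1)) (hMul (loopWeight q) (wjProj q (n + k) k) (basis w.1))
      (TLDiagram.id d) := by
  have hk : k ≤ n + k := Nat.le_add_left k n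
  rw [stdAct_single, stdAct_single, stdForm_restrict, wenzlJones_eq, hStar_hMul, hStar_wjProj hk,
    hMul_assoc, ← hMul_assoc (wjProj q (n + k) k), wjProj_idem hq hk]

lemma seamForm_eq_zero_iff (hq : WJAdmissible q k) :
    seamForm q n k d = 0 ↔ ∀ v w : MonicDiagram (n + k) d,
      hMul (loopWeight q) (hStar (basis v.1))
        (hMul (loopWeight q) (wjProj q (n + k) k) (basis w.1)) (TLDiagram.id d) = 0 := by
  constructor
  · intro h v w
    rw [← stdForm_wenzlJones hq]
    exact LinearMap.congr_fun (LinearMap.congr_fun h ⟨_, Submodule.subset_span ⟨v, rfl⟩⟩)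
      ⟨_, Submodule.subset_span ⟨w, rfl⟩⟩
  · intro h
    ext ⟨x, hx⟩ ⟨y, hy⟩
    change stdForm (loopWeight q) (n + k) d x y = 0
    induction hx using Submodule.span_induction with
    | zero => simp
    | add a b _ _ ha hb => rw [map_add, LinearMap.add_apply, ha, hb, add_zero]
    | smul c a _ ha => rw [map_smul, LinearMap.smul_apply, ha, smul_zero]
    | mem a ha =>
      obtain ⟨v, rfl⟩ := ha
      induction hy using Submodule.span_induction with
      | zero => simp
      | add a b _ _ ha hb => rw [map_add, ha, hb, add_zero]
      | smul c a _ ha => rw [map_smul, ha, smul_zero]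
      | mem b hb =>
        obtain ⟨w, rfl⟩ := hb
        exact (stdForm_wenzlJones hq v w).trans (h v w)

/-! ### Roots of unity -/

/-- `[m] = 0` means `q^{2m} = 1`. When `q` is not a root of unity, `ell q = 0` divides only `m = 0`,
so the statement remains correct. -/
lemma qNum_eq_zero_iff (hq0 : q ≠ 0) (h : q - q⁻¹ ≠ 0) (m : ℕ) :
    qNum q m = 0 ↔ ell q ∣ m := by
  rw [qNum, div_eq_zero_iff, or_iff_left h, sub_eq_zero, ell, orderOf_dvd_iff_pow_eq_one, inv_pow,
    ← mul_eq_one_iff_eq_inv₀ (pow_ne_zero _ hq0), ← pow_mul, two_mul, pow_add]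

lemma wjAdmissible_of_ell (hk : 2 ≤ k) (hq0 : q ≠ 0)
    (hq : (∀ m : ℕ, 0 < m → q ^ m ≠ 1) ∨ k < ell q) : WJAdmissible q k := by
  have hdvd : ∀ j, 1 ≤ j → j ≤ k → ¬ ell q ∣ j := by
    intro j h1 h2 hj
    rcases hq with hq | hq
    · rw [ell, orderOf_dvd_iff_pow_eq_one, ← pow_mul] at hj
      exact hq _ (by omega) hj
    · exact absurd (Nat.le_of_dvd (by omega) hj) (by omega)
  -- Vanishing would mean `q² = 1`, that is `ℓ ∣ 1`: the case `j = 1` of `hdvd`.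
  have hsub : q - q⁻¹ ≠ 0 := fun h => by
    refine hdvd 1 le_rfl (by omega) ?_
    rw [ell, orderOf_dvd_iff_pow_eq_one, pow_one, pow_two]
    nth_rewrite 2 [sub_eq_zero.1 h]
    exact mul_inv_cancel₀ hq0
  exact ⟨hq0, hsub, fun j h1 h2 h => hdvd j h1 h2 ((qNum_eq_zero_iff hq0 hsub j).1 h)⟩

end

theorem mainTheorem7 (n k d : ℕ) (q : ℂ) (hn : 1 ≤ n) (hk : 2 ≤ k) (hq₀ : q ≠ 0)
    (hq : (∀ m : ℕ, 0 < m → q ^ m ≠ 1) ∨ k < ell q) (hd : d ∈ seamDelta n k) :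
    (seamForm q n k d = 0 ↔ d < k ∧ k + 1 ≡ 0 [MOD ell q]) ∧
      (k + 1 ≡ 0 [MOD ell q] ↔ ell q = k + 1) := by
  have hA := wjAdmissible_of_ell hk hq₀ hq
  have hβ := hA.loopWeight_ne_zero hk
  have hkN : k ≤ n + k := Nat.le_add_left k n
  rw [Nat.modEq_zero_iff_dvd, ← qNum_eq_zero_iff hq₀ hA.sub_ne_zero]
  refine ⟨?_, ?_⟩
  · rw [seamForm_eq_zero_iff hA]
    constructor
    · intro h
      obtain ⟨W, hW⟩ := exists_isTestDiagram hd
      have hz := h ⟨W, fun j => ⟨_, hW.link_inr j⟩⟩ ⟨W, fun j => ⟨_, hW.link_inr j⟩⟩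
      by_contra hc
      by_cases hdk : d < k
      · exact hW.form_ne_zero_of_lt hA hβ hkN hdk (fun h0 => hc ⟨hdk, h0⟩) hz
      · exact hW.form_ne_zero_of_le hβ hkN (not_lt.1 hdk) hz
    · rintro ⟨hdk, h0⟩ v w
      exact form_eq_zero hA hβ hkN hdk h0 _ _
  · rw [qNum_eq_zero_iff hq₀ hA.sub_ne_zero]
    constructor
    · intro h
      rcases hq with hq | hq
      · rw [ell, orderOf_dvd_iff_pow_eq_one, ← pow_mul] at h
        exact absurd h (hq _ (by omega))
      · exact le_antisymm (Nat.le_of_dvd (by omega) h) (by omega)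
    · intro h
      rw [h]
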